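/- Let $\xi:\mathbb N\to\mathbb N$ satisfy $\xi(n)=o(n)$. For a reversible circuit $C:\{0,1\}^{n+\xi}\to\{0,1\}^{n+\xi}$ consisting only of NOT and TOFFOLI gates put $gap(C)=\sum_{x\in\{0,1\}^n}(-1)^{C_{n+\xi}(x0^{\xi})}$, where $C_{n+\xi}(x0^\xi)$ is the last bit of $C(x0^\xi)$. Assume the following conjecture (for this $\xi$): for every constant $a>0$ there is a polynomial $p$ such that, whenever a nondeterministic $T(n)$-time algorithm, given the description of any such circuit $C$ with $n\ge 1$ input bits, $\xi=\xi(n)$ ancilla bits and at most $p(n)$ gates, accepts if $gap(C)\neq 0$ and rejects if $gap(C)=0$, then $T(n)>2^{(1-a)n}$ for infinitely many $n$. The $N$-qubit DQC1 model with a unitary $U$ accepts with probability $p_{acc}=\mathrm{Tr}\big[(|0\rangle\langle 0|\otimes I^{\otimes N-1})\,U\,(|0\rangle\langle 0|\otimes I^{\otimes N-1}/2^{N-1})\,U^\dagger\big]$; here $U$ is given by a circuit over the universal gate set NOT, $H$, $T$, CNOT, TOFFOLI. A classical probabilistic algorithm samples $p_{acc}$ within multiplicative error $\epsilon$ if, given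 the description of the circuit, it accepts with a probability $q_{acc}$ such that $|p_{acc}-q_{acc}|\le\epsilon\, p_{acc}$. Then for every constant $a>0$ there are a polynomial $q$ and, for each $n$, an $N$-qubit DQC1 model with $N=n+\xi+2$, $\xi=\xi(n)$, and at most $q(N)$ gates, such that for every classical probabilistic algorithm there are infinitely many $N$ for which the algorithm does not sample the acceptance probability of the model within any multiplicative error $\epsilon<1$ in time $2^{(1-a)(N-\xi-2)}$. Moreover $2^{(1-a)(N-\xi-2)}=2^{(1-a)N+o(N)}$. -/

import Mathlib

open Filter Asymptotics

noncomputable section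

/-! ### Algorithms: programs over finitely many stacks of bits, with coins and a step count -/

/-- Programs over registers holding stacks of bits (a program mentions finitely many registers).
`toss r` pushes onto register `r` a bit that is not determined by the input: a nondeterministic
choice, or a fair coin, according to how the runs are evaluated. -/
inductive Prog : Type
  | skip : Prog
  | push (r : ℕ) (b : Bool) : Prog
  | pop (r : ℕ) : Prog
  | toss (r : ℕ) : Prog
  | seq (P Q : Prog) : Prog
  /-- Three-way branch: the stack `r` is empty, has top `false`, or has top `true`. -/
  | branch (r : ℕ) (P₀ Pf Pt : Prog) : Prog
  /-- Repeat `P` as long as the stack `r` is nonempty. -/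
  | loop (r : ℕ) (P : Prog) : Prog

/-- The contents of the registers; the head of a list is the top of the stack. -/
abbrev Store := ℕ → List Bool

/-- `Exec P σ c t σ'`: started in `σ`, the program `P` halts in `σ'` after exactly `t` elementary
steps, and the bits that it tosses on the way are exactly those of `c`, in this order. -/
inductive Exec : Prog → Store → List Bool → ℕ → Store → Prop
  | skip (σ : Store) : Exec Prog.skip σ [] 1 σ
  | push (r : ℕ) (b : Bool) (σ : Store) :
      Exec (Prog.push r b) σ [] 1 (Function.update σ r (b :: σ r))
  | pop (r : ℕ) (σ : Store) :
      Exec (Prog.pop r) σ [] 1 (Function.update σ r (σ r).tail)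
  | toss (r : ℕ) (b : Bool) (σ : Store) :
      Exec (Prog.toss r) σ [b] 1 (Function.update σ r (b :: σ r))
  | seq {P Q : Prog} {σ₁ σ₂ σ₃ : Store} {c d : List Bool} {s t : ℕ} :
      Exec P σ₁ c s σ₂ → Exec Q σ₂ d t σ₃ → Exec (Prog.seq P Q) σ₁ (c ++ d) (s + t) σ₃
  | branchNil {r : ℕ} {P₀ Pf Pt : Prog} {σ₁ σ₂ : Store} {c : List Bool} {t : ℕ} :
      σ₁ r = [] → Exec P₀ σ₁ c t σ₂ → Exec (Prog.branch r P₀ Pf Pt) σ₁ c (t + 1) σ₂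
  | branchFalse {r : ℕ} {P₀ Pf Pt : Prog} {σ₁ σ₂ : Store} {c : List Bool} {t : ℕ} :
      (σ₁ r).head? = some false → Exec Pf σ₁ c t σ₂ →
        Exec (Prog.branch r P₀ Pf Pt) σ₁ c (t + 1) σ₂
  | branchTrue {r : ℕ} {P₀ Pf Pt : Prog} {σ₁ σ₂ : Store} {c : List Bool} {t : ℕ} :
      (σ₁ r).head? = some true → Exec Pt σ₁ c t σ₂ →
        Exec (Prog.branch r P₀ Pf Pt) σ₁ c (t + 1) σ₂
  | loopDone {r : ℕ} {P : Prog} {σ : Store} :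
      σ r = [] → Exec (Prog.loop r P) σ [] 1 σ
  | loopStep {r : ℕ} {P : Prog} {σ₁ σ₂ σ₃ : Store} {c d : List Bool} {s t : ℕ} :
      σ₁ r ≠ [] → Exec P σ₁ c s σ₂ → Exec (Prog.loop r P) σ₂ d t σ₃ →
        Exec (Prog.loop r P) σ₁ (c ++ d) (s + t + 1) σ₃

/-- The input is placed in register `0`; all the other registers are empty. -/
def Store.input (x : List Bool) : Store := Function.update (fun _ => []) 0 x

/-- Whatever the tossed bits are, `P` halts on the input `x` within `τ` steps. -/
def Prog.HaltsWithin (P : Prog) (x : List Bool) (τ : ℝ) : Prop :=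
  ∀ ω : ℕ → Bool, ∃ (k t : ℕ) (σ : Store),
    Exec P (Store.input x) ((List.range k).map ω) t σ ∧ (t : ℝ) ≤ τ

/-- `P` halts on the input `x` having tossed exactly the bits `c`, with `true` on top of
register `0`. -/
def Prog.AcceptsOn (P : Prog) (x c : List Bool) : Prop :=
  ∃ (t : ℕ) (σ : Store), Exec P (Store.input x) c t σ ∧ (σ 0).head? = some true

/-- Nondeterministic acceptance: some computation path accepts. -/
def Prog.NAccepts (P : Prog) (x : List Bool) : Prop := ∃ c : List Bool, P.AcceptsOn x c

open Classical in
/-- The probability that `P` accepts `x` when the tossed bits are independent fair coins: a halting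
run with tossed bits `c` has probability `2 ^ (-|c|)`. -/
def Prog.acceptProb (P : Prog) (x : List Bool) : ℝ :=
  ∑' c : List Bool, if P.AcceptsOn x c then (1 / 2 : ℝ) ^ c.length else 0

/-- Unary code of a natural number (a prefix code). -/
def unaryCode (k : ℕ) : List Bool := List.replicate k true ++ [false]

/-! ### Classical reversible circuits -/

/-- The action of a NOT on bit `i`. -/
def flipBit {w : ℕ} (i : Fin w) (x : Fin w → Bool) : Fin w → Bool :=
  Function.update x i (!(x i))

/-- The action of a TOFFOLI with controls `i`, `j` and target `k`. -/
def toffoliBit {w : ℕ} (i j k : Fin w) (x : Fin w → Bool) : Fin w → Bool :=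
  Function.update x k (xor (x k) (x i && x j))

/-- The gates of a reversible circuit on `w` bits: NOT and TOFFOLI. -/
inductive RevGate (w : ℕ) : Type
  | not (i : Fin w) : RevGate w
  | toffoli (i j k : Fin w) (hij : i ≠ j) (hik : i ≠ k) (hjk : j ≠ k) : RevGate w

/-- A reversible circuit on `w` bits; its size is the length of the list, and the head of the list
is applied first. -/
abbrev RevCircuit (w : ℕ) := List (RevGate w)

def RevGate.apply {w : ℕ} : RevGate w → (Fin w → Bool) → (Fin w → Bool)
  | .not i => flipBit i
  | .toffoli i j k _ _ _ => toffoliBit i j k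

def RevCircuit.apply {w : ℕ} (C : RevCircuit w) (x : Fin w → Bool) : Fin w → Bool :=
  List.foldl (fun y g => RevGate.apply g y) x C

/-- The last bit of a nonempty bit string. -/
def lastBit {w : ℕ} (y : Fin w → Bool) : Bool :=
  if h : 0 < w then y ⟨w - 1, Nat.sub_one_lt_of_lt h⟩ else false

/-- `∑_x (-1) ^ (last bit of C (x 0^ξ))`, over all `x ∈ {0,1}^n`. -/
def revGap {n ξ : ℕ} (C : RevCircuit (n + ξ)) : ℤ :=
  ∑ x : Fin n → Bool,
    (-1) ^ (lastBit (RevCircuit.apply C (Fin.append x (fun _ : Fin ξ => false)))).toNat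

def RevGate.code {w : ℕ} : RevGate w → List Bool
  | .not i => unaryCode 0 ++ unaryCode i
  | .toffoli i j k _ _ _ => unaryCode 1 ++ unaryCode i ++ unaryCode j ++ unaryCode k

/-- The description of a reversible circuit on `n` input bits and `ξ` ancilla bits. -/
def revCode {n ξ : ℕ} (C : RevCircuit (n + ξ)) : List Bool :=
  unaryCode n ++ unaryCode ξ ++ List.flatMap RevGate.code C

/-- The gap conjecture for NOT/TOFFOLI circuits with `ξ n` ancilla bits: for every `a > 0`, if a
nondeterministic `T n`-time algorithm decides whether the gap of a polynomial-size circuit is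
nonzero (for a suitable polynomial), then `T n > 2 ^ ((1 - a) n)` for infinitely many `n`. -/
def ReversibleGapConjecture (ξ : ℕ → ℕ) : Prop :=
  ∀ a : ℝ, 0 < a → ∃ p : Polynomial ℕ, ∀ (A : Prog) (T : ℕ → ℕ),
    (∀ n : ℕ, 0 < n → ∀ C : RevCircuit (n + ξ n), C.length ≤ p.eval n →
      A.HaltsWithin (revCode C) (T n) ∧ (A.NAccepts (revCode C) ↔ revGap C ≠ 0)) →
    ∃ᶠ n : ℕ in atTop, (2 : ℝ) ^ ((1 - a) * (n : ℝ)) < (T n : ℝ)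

/-! ### Quantum circuits and the one-clean-qubit model -/

/-- Operators on `N` qubits, in the computational basis. -/
abbrev QOp (N : ℕ) := Matrix (Fin N → Bool) (Fin N → Bool) ℂ

/-- The one-qubit operator `M` on qubit `i`, tensored with the identity on the other qubits. -/
def singleQubitOp {N : ℕ} (M : Matrix Bool Bool ℂ) (i : Fin N) : QOp N :=
  Matrix.of fun x y => if ∀ j, j ≠ i → x j = y j then M (x i) (y i) else 0

/-- The operator `|x⟩ ↦ |f x⟩`. -/
def basisMapOp {N : ℕ} (f : (Fin N → Bool) → (Fin N → Bool)) : QOp N :=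
  Matrix.of fun x y => if x = f y then 1 else 0

def hadamardMatrix : Matrix Bool Bool ℂ :=
  Matrix.of fun b c => (if b && c then -1 else 1) / (Real.sqrt 2 : ℂ)

def tMatrix : Matrix Bool Bool ℂ :=
  Matrix.diagonal fun b => if b then Complex.exp (Complex.I * (Real.pi / 4)) else 1

/-- A universal gate set: NOT, Hadamard, `T`, controlled-NOT, TOFFOLI. -/
inductive QGate (N : ℕ) : Type
  | x (i : Fin N) : QGate N
  | h (i : Fin N) : QGate N
  | t (i : Fin N) : QGate N
  | cnot (i j : Fin N) (hij : i ≠ j) : QGate N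
  | toffoli (i j k : Fin N) (hij : i ≠ j) (hik : i ≠ k) (hjk : j ≠ k) : QGate N

/-- A quantum circuit on `N` qubits; its size is the length of the list, and the head of the list
is applied first. -/
abbrev QCircuit (N : ℕ) := List (QGate N)

def QGate.op {N : ℕ} : QGate N → QOp N
  | .x i => basisMapOp (flipBit i)
  | .h i => singleQubitOp hadamardMatrix i
  | .t i => singleQubitOp tMatrix i
  | .cnot i j _ => basisMapOp fun y => Function.update y j (xor (y j) (y i))
  | .toffoli i j k _ _ _ => basisMapOp (toffoliBit i j k)

/-- The unitary operator of a circuit. -/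
def QCircuit.op {N : ℕ} (U : QCircuit N) : QOp N :=
  List.foldl (fun V g => QGate.op g * V) 1 U

def QGate.code {N : ℕ} : QGate N → List Bool
  | .x i => unaryCode 0 ++ unaryCode i
  | .h i => unaryCode 1 ++ unaryCode i
  | .t i => unaryCode 2 ++ unaryCode i
  | .cnot i j _ => unaryCode 3 ++ unaryCode i ++ unaryCode j
  | .toffoli i j k _ _ _ => unaryCode 4 ++ unaryCode i ++ unaryCode j ++ unaryCode k

/-- The description of a quantum circuit. -/
def qCode {N : ℕ} (U : QCircuit N) : List Bool :=
  unaryCode N ++ List.flatMap QGate.code U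

/-- `|0⟩⟨0| ⊗ I^{⊗ (N - 1)}`. -/
def firstZeroProj (N : ℕ) [NeZero N] : QOp N :=
  Matrix.diagonal fun x => if x 0 = false then 1 else 0

/-- `|0⟩⟨0| ⊗ I^{⊗ (N - 1)} / 2 ^ (N - 1)`. -/
def dqc1Initial (N : ℕ) [NeZero N] : QOp N :=
  ((2 : ℂ) ^ (N - 1))⁻¹ • firstZeroProj N

/-- The acceptance probability of the `N`-qubit DQC1 model with the operator `U`: the probability
that the measurement of the first qubit of `U ρ U†` gives `0`, for the initial state `ρ`. -/
def dqc1AcceptProb {N : ℕ} [NeZero N] (U : QOp N) : ℝ :=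
  (Matrix.trace (firstZeroProj N * (U * dqc1Initial N * U.conjTranspose))).re

/-- The probabilistic algorithm `S`, given the description of the circuit `U`, samples the
acceptance probability of the DQC1 model with `U` within the multiplicative error `ε`, in time at
most `τ`. -/
def SamplesDQC1 {N : ℕ} [NeZero N] (S : Prog) (U : QCircuit N) (ε τ : ℝ) : Prop :=
  S.HaltsWithin (qCode U) τ ∧
    |dqc1AcceptProb (QCircuit.op U) - S.acceptProb (qCode U)| ≤ ε * dqc1AcceptProb (QCircuit.op U)

end

/-! From a reversible circuit `C` one builds `gapCircuit`, with two additional qubits, whose DQC1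
acceptance probability is zero exactly when the gap of `C` is zero
(`dqc1AcceptProb_gapCircuit_eq_zero_iff`). Sampling with a multiplicative error below 1 preserves
the distinction between zero and nonzero, so a sampler whose coins are read as guesses is a
nondeterministic test for a nonzero gap (`SamplesDQC1.nAccepts_iff`). Composed with a
polynomial-time compiler from `revCode C` to the description of `gapCircuit` (`exec_compileGap`),
and with a finite table for short inputs, a sampler that succeeded at all large `n` would contradict
the conjecture for an exponent slightly weaker than `1 - a` (`frequently_failsAt`). Hence every
sampler fails at infinitely many `n`, on circuits that depend on the sampler. Programs being
countable, a diagonal choice yields one family of circuits that defeats all of them.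

The circuit works as follows. Let B be the operator of `phaseBlock`. It is symmetric, squares to 1,
preserves qubits 0 and 1, is the identity when qubit 1 is off, and, when qubit 1 is on, has the
entry gap / 2^n at the all-ones data string (`op_phaseBlock_ones`). The middle of the circuit is B F
B, where F flips qubit 1 on all-ones data. At both ends the clean qubit is flipped on all-ones data;
together with the final NOT this leaves only amplitudes between all-ones data on one side and other
data on the other. `offFlip` moves the all-ones strings with qubit 1 off out of the reach of F. If
the gap vanishes, F can be replaced by the identity in these amplitudes, and B B = 1 makes them
zero. If not, the path that starts from all-ones data with qubit 1 off, switches it on by F and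
stays on the diagonal of the second B has amplitude gap / 2^n.

Only one qubit is clean, so the multiply controlled NOT borrows qubit 1, in an unknown state, by the
ladder construction (`op_allOnesFlip`). -/

/-! ### Determinism and halting -/

/-- Comparing the coins of two runs only up to continuations `e`, `e'` is what survives the
induction through `seq` and `loop`. In particular, no halting coin string is a proper prefix of
another. -/
theorem Exec.deterministic {P : Prog} {σ σ' : Store} {c : List Bool} {t : ℕ}
    (h : Exec P σ c t σ') :
    ∀ {c' : List Bool} {t' : ℕ} {σ'' : Store}, Exec P σ c' t' σ'' →
      ∀ e e' : List Bool, c ++ e = c' ++ e' → c = c' ∧ t = t' ∧ σ' = σ'' := by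
  induction h with
  | skip σ => intro c' t' σ'' h' e e' _; cases h'; simp
  | push r b σ => intro c' t' σ'' h' e e' _; cases h'; simp
  | pop r σ => intro c' t' σ'' h' e e' _; cases h'; simp
  | toss r b σ =>
    intro c' t' σ'' h' e e' he
    cases h'
    simp only [List.cons_append, List.nil_append, List.cons.injEq] at he
    simp [he.1]
  | seq h₁ h₂ ih₁ ih₂ =>
    intro c' t' σ'' h' e e' he
    cases h' with
    | seq k₁ k₂ =>
      obtain ⟨rfl, rfl, rfl⟩ := ih₁ k₁ _ _ (by simpa only [List.append_assoc] using he)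
      have he' := he
      simp only [List.append_assoc, List.append_cancel_left_eq] at he'
      obtain ⟨rfl, rfl, rfl⟩ := ih₂ k₂ _ _ he'
      simp
  | branchNil hr h₁ ih =>
    intro c' t' σ'' h' e e' he
    cases h' with
    | branchNil _ k => obtain ⟨rfl, rfl, rfl⟩ := ih k _ _ he; simp
    | branchFalse hr' k => simp [hr] at hr'
    | branchTrue hr' k => simp [hr] at hr'
  | branchFalse hr h₁ ih =>
    intro c' t' σ'' h' e e' he
    cases h' with
    | branchNil hr' k => simp [hr'] at hr
    | branchFalse hr' k => obtain ⟨rfl, rfl, rfl⟩ := ih k _ _ he; simp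
    | branchTrue hr' k => simp [hr] at hr'
  | branchTrue hr h₁ ih =>
    intro c' t' σ'' h' e e' he
    cases h' with
    | branchNil hr' k => simp [hr'] at hr
    | branchFalse hr' k => simp [hr] at hr'
    | branchTrue hr' k => obtain ⟨rfl, rfl, rfl⟩ := ih k _ _ he; simp
  | loopDone hr =>
    intro c' t' σ'' h' e e' he
    cases h' with
    | loopDone _ => simp
    | loopStep hr' _ _ => exact absurd hr hr'
  | loopStep hr h₁ h₂ ih₁ ih₂ =>
    intro c' t' σ'' h' e e' he
    cases h' with
    | loopDone hr' => exact absurd hr' hr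
    | loopStep _ k₁ k₂ =>
      obtain ⟨rfl, rfl, rfl⟩ := ih₁ k₁ _ _ (by simpa only [List.append_assoc] using he)
      have he' := he
      simp only [List.append_assoc, List.append_cancel_left_eq] at he'
      obtain ⟨rfl, rfl, rfl⟩ := ih₂ k₂ _ _ he'
      simp

theorem Exec.length_le {P : Prog} {σ σ' : Store} {c : List Bool} {t : ℕ}
    (h : Exec P σ c t σ') : c.length ≤ t := by
  induction h <;>
    first
    | omega
    | simp only [List.length_nil, List.length_cons, List.length_append]
      omega

/-- Continue `c` by zeros to an infinite coin sequence: by determinism, the run that halts in time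
on this sequence is the accepting run, and a step tosses at most one coin. -/
theorem Prog.HaltsWithin.length_le {P : Prog} {x : List Bool} {τ : ℝ} (h : P.HaltsWithin x τ)
    {c : List Bool} (hc : P.AcceptsOn x c) : (c.length : ℝ) ≤ τ := by
  obtain ⟨t, σ, hex, -⟩ := hc
  obtain ⟨k, t', σ', hex', ht'⟩ := h fun i => c.getD i false
  set ω : ℕ → Bool := fun i => c.getD i false
  have hω : c = (List.range c.length).map ω := by
    refine List.ext_getElem (by simp) fun i h₁ h₂ => ?_
    simp [ω, h₁]
  -- Both coin strings are prefixes of the first `max c.length k` bits of `ω`; this is the common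
  -- continuation for `Exec.deterministic`.
  have hpre : ∀ j, j ≤ max c.length k →
      (List.range j).map ω ++ ((List.range (max c.length k)).map ω).drop j =
        (List.range (max c.length k)).map ω := by
    intro j hj
    conv_rhs => rw [← List.take_append_drop j ((List.range (max c.length k)).map ω)]
    rw [← List.map_take, List.take_range, min_eq_left hj]
  rw [hω] at hex
  obtain ⟨hcc, htt, -⟩ := hex.deterministic hex' _ _
    ((hpre _ (le_max_left _ _)).trans (hpre _ (le_max_right _ _)).symm)
  have := hex.length_le
  rw [← hω, htt] at this
  exact (Nat.cast_le.mpr this).trans ht'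

/-- The time bound leaves finitely many accepting coin strings, so the series is summable; its terms
are nonnegative, and each accepting string contributes a positive one. -/
theorem Prog.HaltsWithin.acceptProb_eq_zero_iff {P : Prog} {x : List Bool} {τ : ℝ}
    (h : P.HaltsWithin x τ) : P.acceptProb x = 0 ↔ ¬ P.NAccepts x := by
  classical
  unfold Prog.acceptProb Prog.NAccepts
  have hfin : (Function.support fun c : List Bool =>
      if P.AcceptsOn x c then (1 / 2 : ℝ) ^ c.length else 0).Finite := by
    refine (List.finite_length_le Bool ⌊τ⌋₊).subset fun c hc => ?_
    have hacc : P.AcceptsOn x c := by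
      by_contra hn
      simp [hn] at hc
    exact Nat.le_floor (h.length_le hacc)
  have hs := summable_of_hasFiniteSupport (L := SummationFilter.unconditional _) hfin
  have hnn : ∀ c : List Bool,
      0 ≤ (if P.AcceptsOn x c then (1 / 2 : ℝ) ^ c.length else 0) := by
    intro c; split_ifs <;> positivity
  constructor
  · rintro h0 ⟨c, hc⟩
    have := hs.le_tsum c fun j _ => hnn j
    have h0' : (∑' c : List Bool, if P.AcceptsOn x c then (1 / 2 : ℝ) ^ c.length else 0) = 0 := by
      convert h0
    rw [h0', if_pos hc] at this
    have : (0 : ℝ) < (1 / 2) ^ c.length := by positivity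
    linarith
  · intro hn
    push Not at hn
    simp [hn]

/-! ### Reduction of one program to another -/

/-- Started in `σ`, the program `A` behaves as `B` started in `σ'`, after `d` further steps. -/
def Reduces (A : Prog) (σ : Store) (B : Prog) (σ' : Store) (d : ℕ) : Prop :=
  (∀ c t τ, Exec B σ' c t τ → Exec A σ c (t + d) τ) ∧
    ∀ c t τ, Exec A σ c t τ → ∃ t', Exec B σ' c t' τ

theorem Reduces.trans {A B C : Prog} {σ₁ σ₂ σ₃ : Store} {d e : ℕ}
    (h : Reduces A σ₁ B σ₂ d) (h' : Reduces B σ₂ C σ₃ e) : Reduces A σ₁ C σ₃ (d + e) := by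
  refine ⟨fun c t τ hc => ?_, fun c t τ hc => ?_⟩
  · have := h.1 _ _ _ (h'.1 _ _ _ hc)
    rwa [add_assoc, add_comm e d] at this
  · obtain ⟨t', ht'⟩ := h.2 _ _ _ hc
    exact h'.2 _ _ _ ht'

/-- Since `P` tosses nothing, determinism forces every run of the composite through `σ'`. -/
theorem Reduces.seq {P Q : Prog} {σ σ' : Store} {d : ℕ} (h : Exec P σ [] d σ') :
    Reduces (Prog.seq P Q) σ Q σ' d := by
  refine ⟨fun c t τ hc => ?_, fun c t τ hc => ?_⟩
  · have := h.seq hc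
    rwa [List.nil_append, add_comm] at this
  · cases hc with
    | @seq _ _ _ σ₂ _ c₁ c₂ s t k₁ k₂ =>
      obtain ⟨rfl, rfl, rfl⟩ := h.deterministic k₁ (c₁ ++ []) [] (by simp)
      exact ⟨_, k₂⟩

theorem Reduces.branch_nil {r : ℕ} {P₀ Pf Pt : Prog} {σ : Store} (h : σ r = []) :
    Reduces (Prog.branch r P₀ Pf Pt) σ P₀ σ 1 := by
  refine ⟨fun c t τ hc => hc.branchNil h, fun c t τ hc => ?_⟩
  cases hc with
  | branchNil _ k => exact ⟨_, k⟩
  | branchFalse h' k => simp [h] at h'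
  | branchTrue h' k => simp [h] at h'

theorem Reduces.branch_cons {r : ℕ} {P₀ Pf Pt : Prog} {σ : Store} {b : Bool} {l : List Bool}
    (h : σ r = b :: l) :
    Reduces (Prog.branch r P₀ Pf Pt) σ (bif b then Pt else Pf) σ 1 := by
  cases b with
  | false =>
    refine ⟨fun c t τ hc => hc.branchFalse (by simp [h]), fun c t τ hc => ?_⟩
    cases hc with
    | branchNil h' k => simp [h] at h'
    | branchFalse _ k => exact ⟨_, k⟩
    | branchTrue h' k => simp [h] at h'
  | true =>
    refine ⟨fun c t τ hc => hc.branchTrue (by simp [h]), fun c t τ hc => ?_⟩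
    cases hc with
    | branchNil h' k => simp [h] at h'
    | branchFalse h' k => simp [h] at h'
    | branchTrue _ k => exact ⟨_, k⟩

theorem Reduces.haltsWithin {A B : Prog} {x y : List Bool} {d : ℕ} {τ : ℝ}
    (h : Reduces A (Store.input x) B (Store.input y) d) (hB : B.HaltsWithin y τ) :
    A.HaltsWithin x (τ + d) := by
  intro ω
  obtain ⟨k, t, σ, hex, ht⟩ := hB ω
  exact ⟨k, t + d, σ, h.1 _ _ _ hex, by push_cast; linarith⟩

theorem Reduces.nAccepts_iff {A B : Prog} {x y : List Bool} {d : ℕ}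
    (h : Reduces A (Store.input x) B (Store.input y) d) : A.NAccepts x ↔ B.NAccepts y := by
  constructor
  · rintro ⟨c, t, σ, hex, hσ⟩
    obtain ⟨t', ht'⟩ := h.2 _ _ _ hex
    exact ⟨c, t', σ, ht', hσ⟩
  · rintro ⟨c, t, σ, hex, hσ⟩
    exact ⟨c, t + d, σ, h.1 _ _ _ hex, hσ⟩

/-! ### Finite lookup tables -/

/-- Push the bits of a fixed list onto a register, the head first. -/
def pushAll (r : ℕ) : List Bool → Prog
  | [] => Prog.skip
  | b :: l => Prog.seq (Prog.push r b) (pushAll r l)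

theorem exec_pushAll (r : ℕ) (l : List Bool) (σ : Store) :
    Exec (pushAll r l) σ [] (l.length + 1) (Function.update σ r (l.reverse ++ σ r)) := by
  induction l generalizing σ with
  | nil => simpa [pushAll] using Exec.skip σ
  | cons b l ih =>
    have := (Exec.push r b σ).seq (ih (Function.update σ r (b :: σ r)))
    simpa [pushAll, add_comm] using this

/-- Answer with `f` on the inputs shorter than `L` (the bits in `acc` have been read already), and
run `P` on the others. -/
def lookupFrom (f : List Bool → Bool) (P : Prog) : ℕ → List Bool → Prog
  | 0, acc => Prog.seq (pushAll 0 acc) P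
  | L + 1, acc =>
    Prog.branch 0 (Prog.push 0 (f acc.reverse))
      (Prog.seq (Prog.pop 0) (lookupFrom f P L (false :: acc)))
      (Prog.seq (Prog.pop 0) (lookupFrom f P L (true :: acc)))

theorem Store.update_input (x y : List Bool) :
    Function.update (Store.input x) 0 y = Store.input y := by
  simp [Store.input]

theorem Store.input_zero (x : List Bool) : Store.input x 0 = x := by
  simp [Store.input]

theorem lookupFrom_cons (f : List Bool → Bool) (P : Prog) (L : ℕ) (acc : List Bool) (b : Bool)
    (y : List Bool) :
    Reduces (lookupFrom f P (L + 1) acc) (Store.input (b :: y))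
      (lookupFrom f P L (b :: acc)) (Store.input y) 2 := by
  have h₁ := Reduces.branch_cons (P₀ := Prog.push 0 (f acc.reverse))
    (Pf := Prog.seq (Prog.pop 0) (lookupFrom f P L (false :: acc)))
    (Pt := Prog.seq (Prog.pop 0) (lookupFrom f P L (true :: acc)))
    (Store.input_zero (b :: y))
  refine h₁.trans (e := 1) ?_
  have h₂ := Exec.pop 0 (Store.input (b :: y))
  rw [Store.input_zero, List.tail_cons, Store.update_input] at h₂
  cases b <;> exact Reduces.seq h₂

/-- The bits already read stand in `acc` with the latest first, so pushing them back from the head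
restores the input for `P`. -/
theorem lookupFrom_long (f : List Bool → Bool) (P : Prog) (L : ℕ) (acc y : List Bool)
    (h : L ≤ y.length) :
    ∃ d ≤ 3 * L + acc.length + 1,
      Reduces (lookupFrom f P L acc) (Store.input y) P (Store.input (acc.reverse ++ y)) d := by
  induction L generalizing acc y with
  | zero =>
    refine ⟨acc.length + 1, by omega, Reduces.seq ?_⟩
    have := exec_pushAll 0 acc (Store.input y)
    rwa [Store.input_zero, Store.update_input] at this
  | succ L ih =>
    cases y with
    | nil => simp at h
    | cons b y =>
      obtain ⟨d, hd, hr⟩ := ih (b :: acc) y (by simpa using h)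
      refine ⟨2 + d, by simp at hd; omega, (lookupFrom_cons f P L acc b y).trans ?_⟩
      simpa using hr

theorem lookupFrom_short (f : List Bool → Bool) (P : Prog) (L : ℕ) (acc y : List Bool)
    (h : y.length < L) :
    ∃ d ≤ 2 * L, Reduces (lookupFrom f P L acc) (Store.input y)
      (Prog.push 0 (f (acc.reverse ++ y))) (Store.input []) d := by
  induction L generalizing acc y with
  | zero => simp at h
  | succ L ih =>
    cases y with
    | nil =>
      refine ⟨1, by omega, ?_⟩
      simpa [lookupFrom] using Reduces.branch_nil (Store.input_zero [])
    | cons b y =>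
      obtain ⟨d, hd, hr⟩ := ih (b :: acc) y (by simpa using h)
      refine ⟨2 + d, by omega, (lookupFrom_cons f P L acc b y).trans ?_⟩
      simpa using hr

theorem haltsWithin_push (b : Bool) (x : List Bool) : (Prog.push 0 b).HaltsWithin x 1 :=
  fun _ => ⟨0, 1, _, Exec.push 0 b _, by simp⟩

theorem nAccepts_push_iff (b : Bool) (x : List Bool) :
    (Prog.push 0 b).NAccepts x ↔ b = true := by
  constructor
  · rintro ⟨c, t, σ, hex, hσ⟩
    cases hex
    simpa using hσ
  · rintro rfl
    exact ⟨[], 1, _, Exec.push 0 true _, by simp⟩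

/-! ### Countability of the set of programs -/

/-- A Gödel number of a program. -/
def Prog.toNat : Prog → ℕ
  | .skip => Nat.pair 0 0
  | .push r b => Nat.pair 1 (Nat.pair r b.toNat)
  | .pop r => Nat.pair 2 r
  | .toss r => Nat.pair 3 r
  | .seq P Q => Nat.pair 4 (Nat.pair P.toNat Q.toNat)
  | .branch r P Q R => Nat.pair 5 (Nat.pair r (Nat.pair P.toNat (Nat.pair Q.toNat R.toNat)))
  | .loop r P => Nat.pair 6 (Nat.pair r P.toNat)

theorem Prog.toNat_injective : Function.Injective Prog.toNat := by
  intro P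
  induction P with
  | skip => intro Q h; cases Q <;> simp_all [Prog.toNat]
  | push r b =>
    intro Q h
    cases Q <;> simp_all [Prog.toNat]
    rename_i b'
    revert h
    cases b <;> cases b' <;> simp
  | pop r => intro Q h; cases Q <;> simp_all [Prog.toNat]
  | toss r => intro Q h; cases Q <;> simp_all [Prog.toNat]
  | seq P Q ihP ihQ =>
    intro R h
    cases R <;> simp only [Prog.toNat, Nat.pair_eq_pair] at h <;> try omega
    rw [ihP h.2.1, ihQ h.2.2]
  | branch r P Q R ihP ihQ ihR =>
    intro R h
    cases R <;> simp only [Prog.toNat, Nat.pair_eq_pair] at h <;> try omega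
    rw [h.2.1, ihP h.2.2.1, ihQ h.2.2.2.1, ihR h.2.2.2.2]
  | loop r P ih =>
    intro R h
    cases R <;> simp only [Prog.toNat, Nat.pair_eq_pair] at h <;> try omega
    rw [h.2.1, ih h.2.2]

instance : Countable Prog := Prog.toNat_injective.countable

/-! ### Injectivity of the descriptions of reversible circuits -/

theorem unaryCode_append_inj {a b : ℕ} {x y : List Bool}
    (h : unaryCode a ++ x = unaryCode b ++ y) : a = b ∧ x = y := by
  induction a generalizing b with
  | zero => cases b <;> simp_all [unaryCode, List.replicate_succ]
  | succ a ih =>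
    cases b with
    | zero => simp [unaryCode, List.replicate_succ] at h
    | succ b =>
      simp only [unaryCode, List.replicate_succ, List.cons_append, List.cons.injEq,
        true_and] at h
      obtain ⟨rfl, rfl⟩ := ih h
      simp

theorem RevGate.code_append_inj {w : ℕ} {g g' : RevGate w} {x y : List Bool}
    (h : g.code ++ x = g'.code ++ y) : g = g' ∧ x = y := by
  cases g <;> cases g' <;> simp only [RevGate.code, List.append_assoc] at h
  · obtain ⟨-, h⟩ := unaryCode_append_inj h
    obtain ⟨h₁, rfl⟩ := unaryCode_append_inj h
    simp [Fin.ext h₁]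
  · exact absurd (unaryCode_append_inj h).1 (by simp)
  · exact absurd (unaryCode_append_inj h).1 (by simp)
  · obtain ⟨-, h⟩ := unaryCode_append_inj h
    obtain ⟨h₁, h⟩ := unaryCode_append_inj h
    obtain ⟨h₂, h⟩ := unaryCode_append_inj h
    obtain ⟨h₃, rfl⟩ := unaryCode_append_inj h
    simp [Fin.ext h₁, Fin.ext h₂, Fin.ext h₃]

theorem RevGate.code_ne_nil {w : ℕ} (g : RevGate w) : g.code ≠ [] := by
  cases g <;> simp [RevGate.code, unaryCode]

theorem flatMap_code_injective {w : ℕ} :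
    Function.Injective fun C : RevCircuit w => List.flatMap RevGate.code C := by
  intro C
  induction C with
  | nil =>
    intro D h
    cases D with
    | nil => rfl
    | cons g D => simp [RevGate.code_ne_nil] at h
  | cons g C ih =>
    intro D h
    cases D with
    | nil => simp [RevGate.code_ne_nil] at h
    | cons g' D =>
      simp only [List.flatMap_cons] at h
      obtain ⟨hg, hC⟩ := RevGate.code_append_inj h
      rw [hg, ih hC]

/-- This makes `gapTable` consistent: a description determines its circuit, hence its gap. -/
theorem revCode_injective {ξ : ℕ → ℕ} {n n' : ℕ} {C : RevCircuit (n + ξ n)}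
    {C' : RevCircuit (n' + ξ n')}
    (h : revCode C = revCode C') :
    n = n' ∧ HEq C C' := by
  simp only [revCode, List.append_assoc] at h
  obtain ⟨rfl, h⟩ := unaryCode_append_inj h
  obtain ⟨-, h⟩ := unaryCode_append_inj h
  exact ⟨rfl, heq_of_eq (flatMap_code_injective h)⟩

/-! ### Programs that emit bits -/

/-- A stack holding the number `k` in unary. -/
abbrev ones (k : ℕ) : List Bool := List.replicate k true

/-- Without tossing, in at most `T` steps, `P` changes the contents of the registers other than `0`
from `ρ` to `ρ'`, and puts the word `w` on top of register `0`. -/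
def Emits (ρ ρ' : Store) (P : Prog) (T : ℕ) (w : List Bool) : Prop :=
  ∀ o, ∃ t ≤ T, Exec P (Function.update ρ 0 o) [] t (Function.update ρ' 0 (w ++ o))

namespace Emits

variable {ρ ρ₁ ρ₂ ρ' : Store} {P Q : Prog} {T T' T₁ T₂ : ℕ} {w w' w₁ w₂ : List Bool}

theorem congr (h : Emits ρ ρ₁ P T w) (hρ : ρ₁ = ρ') (hT : T ≤ T') (hw : w = w') :
    Emits ρ ρ' P T' w' := by
  subst hρ hw
  intro o
  obtain ⟨t, ht, hex⟩ := h o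
  exact ⟨t, ht.trans hT, hex⟩

/-- Register `0` is a stack, so later output stands in front. All emitting programs therefore write
a description from its end to its beginning. -/
theorem seq (h₁ : Emits ρ ρ₁ P T₁ w₁) (h₂ : Emits ρ₁ ρ₂ Q T₂ w₂) :
    Emits ρ ρ₂ (Prog.seq P Q) (T₁ + T₂) (w₂ ++ w₁) := by
  intro o
  obtain ⟨t₁, ht₁, hex₁⟩ := h₁ o
  obtain ⟨t₂, ht₂, hex₂⟩ := h₂ (w₁ ++ o)
  refine ⟨t₁ + t₂, by omega, ?_⟩
  have := hex₁.seq hex₂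
  simpa using this

theorem push_out (ρ : Store) (b : Bool) : Emits ρ ρ (Prog.push 0 b) 1 [b] := by
  intro o
  have := Exec.push 0 b (Function.update ρ 0 o)
  exact ⟨1, le_rfl, by simpa using this⟩

theorem pushAll_out (ρ : Store) (w : List Bool) :
    Emits ρ ρ (pushAll 0 w.reverse) (w.length + 1) w := by
  intro o
  have := exec_pushAll 0 w.reverse (Function.update ρ 0 o)
  exact ⟨w.length + 1, le_rfl, by simpa using this⟩

theorem skip (ρ : Store) : Emits ρ ρ Prog.skip 1 [] :=
  fun _ => ⟨1, le_rfl, Exec.skip _⟩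

theorem push {r : ℕ} (hr : r ≠ 0) (ρ : Store) (b : Bool) :
    Emits ρ (Function.update ρ r (b :: ρ r)) (Prog.push r b) 1 [] := by
  intro o
  have := Exec.push r b (Function.update ρ 0 o)
  rw [Function.update_comm hr.symm, Function.update_of_ne hr] at this
  exact ⟨1, le_rfl, this⟩

theorem pop {r : ℕ} (hr : r ≠ 0) (ρ : Store) :
    Emits ρ (Function.update ρ r (ρ r).tail) (Prog.pop r) 1 [] := by
  intro o
  have := Exec.pop r (Function.update ρ 0 o)
  rw [Function.update_comm hr.symm, Function.update_of_ne hr] at this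
  exact ⟨1, le_rfl, this⟩

theorem branch_nil {r : ℕ} {P₀ Pf Pt : Prog} (hr : r ≠ 0) (h : ρ r = [])
    (hP : Emits ρ ρ' P₀ T w) : Emits ρ ρ' (Prog.branch r P₀ Pf Pt) (T + 1) w := by
  intro o
  obtain ⟨t, ht, hex⟩ := hP o
  exact ⟨t + 1, by omega, hex.branchNil (by simp [hr, h])⟩

theorem branch_cons {r : ℕ} {P₀ Pf Pt : Prog} {b : Bool} {l : List Bool} (hr : r ≠ 0)
    (h : ρ r = b :: l) (hP : Emits ρ ρ' (bif b then Pt else Pf) T w) :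
    Emits ρ ρ' (Prog.branch r P₀ Pf Pt) (T + 1) w := by
  intro o
  obtain ⟨t, ht, hex⟩ := hP o
  refine ⟨t + 1, by omega, ?_⟩
  cases b with
  | false => exact hex.branchFalse (by simp [hr, h])
  | true => exact hex.branchTrue (by simp [hr, h])

theorem loop_done {r : ℕ} (hr : r ≠ 0) (h : ρ r = []) : Emits ρ ρ (Prog.loop r P) 1 [] :=
  fun o => ⟨1, le_rfl, Exec.loopDone (by simp [hr, h])⟩

theorem loop_step {r : ℕ} (hr : r ≠ 0) (h : ρ r ≠ []) (h₁ : Emits ρ ρ₁ P T₁ w₁)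
    (h₂ : Emits ρ₁ ρ₂ (Prog.loop r P) T₂ w₂) :
    Emits ρ ρ₂ (Prog.loop r P) (T₁ + T₂ + 1) (w₂ ++ w₁) := by
  intro o
  obtain ⟨t₁, ht₁, hex₁⟩ := h₁ o
  obtain ⟨t₂, ht₂, hex₂⟩ := h₂ (w₁ ++ o)
  refine ⟨t₁ + t₂ + 1, by omega, ?_⟩
  have := Exec.loopStep (by simpa [hr] using h) hex₁ hex₂
  simpa using this

/-- Here `f i` is the invariant store after `i` rounds; the reversed range is due to the stack order
of the output. -/
theorem loop {r : ℕ} (hr : r ≠ 0) (f : ℕ → Store) (W : ℕ → List Bool) (k : ℕ)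
    (hne : ∀ i < k, f i r ≠ []) (hstep : ∀ i < k, Emits (f i) (f (i + 1)) P T (W i))
    (hk : f k r = []) :
    Emits (f 0) (f k) (Prog.loop r P) (k * (T + 1) + 1) ((List.range k).reverse.flatMap W) := by
  induction k generalizing f W with
  | zero => simpa using loop_done hr hk
  | succ k ih =>
    have h := loop_step hr (hne 0 (by omega)) (hstep 0 (by omega))
      (ih (fun i => f (i + 1)) (fun i => W (i + 1)) (fun i hi => hne _ (by omega))
        (fun i hi => hstep _ (by omega)) hk)
    refine h.congr rfl (by ring_nf; omega) ?_
    rw [List.range_succ_eq_map]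
    simp [List.flatMap_map, ← List.map_reverse]

end Emits

-- Arithmetic on unary counters and transfers between registers

infixr:65 " ⨾ " => Prog.seq

/-- Transfer a unary number from `r` to `s`. -/
def moveCount (r s : ℕ) : Prog := Prog.loop r (Prog.pop r ⨾ Prog.push s true)

theorem emits_moveCount {ρ : Store} {r s k : ℕ} (hr : r ≠ 0) (hs : s ≠ 0) (hrs : r ≠ s)
    (h : ρ r = ones k) :
    Emits ρ (Function.update (Function.update ρ r []) s (ones k ++ ρ s)) (moveCount r s)
      (3 * k + 1) [] := by
  induction k generalizing ρ with
  | zero =>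
    refine (Emits.loop_done hr h).congr ?_ (by omega) rfl
    funext x; simp only [Function.update_apply]; split_ifs <;> simp_all
  | succ k ih =>
    refine (Emits.loop_step hr (by simp [h, List.replicate_succ])
      ((Emits.pop hr ρ).seq (Emits.push hs _ true)) (ih ?_)).congr ?_ (by omega) rfl
    · simp [hrs, h]
    · funext x; simp only [Function.update_apply]
      split_ifs <;> simp_all [List.replicate_succ']

/-- Transfer a unary number from `r` to both `s` and `d`. -/
def dupCount (r s d : ℕ) : Prog :=
  Prog.loop r (Prog.pop r ⨾ Prog.push s true ⨾ Prog.push d true)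

theorem emits_dupCount {ρ : Store} {r s d k : ℕ} (hr : r ≠ 0) (hs : s ≠ 0) (hd : d ≠ 0)
    (hrs : r ≠ s) (hrd : r ≠ d) (hsd : s ≠ d) (h : ρ r = ones k) :
    Emits ρ (Function.update (Function.update (Function.update ρ r []) s (ones k ++ ρ s))
      d (ones k ++ ρ d)) (dupCount r s d) (4 * k + 1) [] := by
  induction k generalizing ρ with
  | zero =>
    refine (Emits.loop_done hr h).congr ?_ (by omega) rfl
    funext x; simp only [Function.update_apply]; split_ifs <;> simp_all
  | succ k ih =>
    refine (Emits.loop_step hr (by simp [h, List.replicate_succ])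
      ((Emits.pop hr ρ).seq ((Emits.push hs _ true).seq (Emits.push hd _ true)))
      (ih ?_)).congr ?_ (by omega) rfl
    · simp [hrs, hrd, h]
    · funext x; simp only [Function.update_apply]
      split_ifs <;> simp_all [List.replicate_succ']

theorem emits_dupCount_out {ρ : Store} {r s k : ℕ} (hr : r ≠ 0) (hs : s ≠ 0)
    (hrs : r ≠ s) (h : ρ r = ones k) :
    Emits ρ (Function.update (Function.update ρ r []) s (ones k ++ ρ s)) (dupCount r s 0)
      (4 * k + 1) (ones k) := by
  induction k generalizing ρ with
  | zero =>
    refine (Emits.loop_done hr h).congr ?_ (by omega) rfl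
    funext x; simp only [Function.update_apply]; split_ifs <;> simp_all
  | succ k ih =>
    refine (Emits.loop_step hr (by simp [h, List.replicate_succ])
      ((Emits.pop hr ρ).seq ((Emits.push hs _ true).seq (Emits.push_out _ true)))
      (ih ?_)).congr ?_ (by omega) ?_
    · simp [hrs, h]
    · funext x; simp only [Function.update_apply]
      split_ifs <;> simp_all [List.replicate_succ']
    · simp [List.replicate_succ']

/-- Emit the unary number in `r`, using the empty register `s`. -/
def emitCount (r s : ℕ) : Prog := dupCount r s 0 ⨾ moveCount s r

theorem emits_emitCount {ρ : Store} {r s k : ℕ} (hr : r ≠ 0) (hs : s ≠ 0)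
    (hrs : r ≠ s) (h : ρ r = ones k) (h' : ρ s = []) :
    Emits ρ ρ (emitCount r s) (7 * k + 2) (ones k) := by
  refine ((emits_dupCount_out hr hs hrs h).seq
    (emits_moveCount (k := k) hs hr hrs.symm ?_)).congr ?_ (by omega) rfl
  · simp [h']
  · funext x; simp only [Function.update_apply]; split_ifs <;> simp_all

/-- Add the unary number in `r` to `d`, using the empty register `s`. -/
def addCount (r s d : ℕ) : Prog := dupCount r s d ⨾ moveCount s r

theorem emits_addCount {ρ : Store} {r s d k : ℕ} (hr : r ≠ 0) (hs : s ≠ 0) (hd : d ≠ 0)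
    (hrs : r ≠ s) (hrd : r ≠ d) (hsd : s ≠ d) (h : ρ r = ones k) (h' : ρ s = []) :
    Emits ρ (Function.update ρ d (ones k ++ ρ d)) (addCount r s d) (7 * k + 2) [] := by
  refine ((emits_dupCount hr hs hd hrs hrd hsd h).seq
    (emits_moveCount (k := k) hs hr hrs.symm ?_)).congr ?_ (by omega) rfl
  · simp [h', hsd]
  · funext x; simp only [Function.update_apply]; split_ifs <;> simp_all

/-- Empty the register `r`. -/
def clear (r : ℕ) : Prog := Prog.loop r (Prog.pop r)

theorem emits_clear {ρ : Store} {r : ℕ} {l : List Bool} (hr : r ≠ 0) (h : ρ r = l) :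
    Emits ρ (Function.update ρ r []) (clear r) (2 * l.length + 1) [] := by
  induction l generalizing ρ with
  | nil =>
    refine (Emits.loop_done hr h).congr ?_ (by omega) rfl
    rw [← h, Function.update_eq_self]
  | cons b l ih =>
    refine (Emits.loop_step hr (by simp [h]) (Emits.pop hr ρ) (ih ?_)).congr ?_
      (by simp; omega) rfl
    · simp [h]
    · simp

/-- Distribute the unary number in `r` evenly to `s` and `d`. -/
def halve (r s d : ℕ) : Prog :=
  Prog.loop r (Prog.pop r ⨾ Prog.push s true ⨾
    Prog.branch r Prog.skip Prog.skip (Prog.pop r ⨾ Prog.push d true))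

/-- A full round removes two units, so the induction descends by two; an odd last unit goes to `s`.
-/
theorem emits_halve {r s d : ℕ} (hr : r ≠ 0) (hs : s ≠ 0) (hd : d ≠ 0)
    (hrs : r ≠ s) (hrd : r ≠ d) (hsd : s ≠ d) (k : ℕ) :
    ∀ {ρ : Store}, ρ r = ones k →
    Emits ρ (Function.update (Function.update (Function.update ρ r [])
      s (ones ((k + 1) / 2) ++ ρ s)) d (ones (k / 2) ++ ρ d)) (halve r s d) (6 * k + 1) [] := by
  induction k using Nat.strong_induction_on with
  | _ k ih =>
    intro ρ h
    obtain rfl | rfl | ⟨k, rfl⟩ : k = 0 ∨ k = 1 ∨ ∃ j, k = j + 2 := by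
      rcases k with _ | _ | k
      exacts [Or.inl rfl, Or.inr (Or.inl rfl), Or.inr (Or.inr ⟨k, rfl⟩)]
    · clear ih
      refine (Emits.loop_done hr h).congr ?_ (by omega) rfl
      funext x; simp only [Function.update_apply]; split_ifs <;> simp_all
    · clear ih
      refine (Emits.loop_step hr (by simp [h])
        ((Emits.pop hr ρ).seq ((Emits.push hs _ true).seq
          (Emits.branch_nil hr ?_ (Emits.skip _))))
        (Emits.loop_done hr ?_)).congr ?_ (by omega) rfl
      · simp [hrs, h]
      · simp [hrs, h]
      · funext x; simp only [Function.update_apply]; split_ifs <;> simp_all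
    · refine (Emits.loop_step hr (by simp [h, List.replicate_succ])
        ((Emits.pop hr ρ).seq ((Emits.push hs _ true).seq
          (Emits.branch_cons (b := true) (l := ones k) hr ?_
            ((Emits.pop hr _).seq (Emits.push hd _ true)))))
        (ih k (by omega) ?_)).congr ?_ (by omega) rfl
      · simp [hrs, h, List.replicate_succ]
      · simp [hrs, hrd, h]
      · have e₁ : (k + 2 + 1) / 2 = (k + 1) / 2 + 1 := by omega
        have e₂ : (k + 2) / 2 = k / 2 + 1 := by omega
        rw [e₁, e₂]
        funext x; simp only [Function.update_apply]
        split_ifs <;> simp_all [List.replicate_succ']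

/-- Read a unary code from the register `s` into `c`, using the empty register `3`. -/
def readCount (s c : ℕ) : Prog :=
  Prog.push 3 true ⨾ Prog.loop 3
    (Prog.branch s Prog.skip (Prog.pop s ⨾ Prog.pop 3) (Prog.pop s ⨾ Prog.push c true))

theorem unaryCode_succ (k : ℕ) : unaryCode (k + 1) = true :: unaryCode k := by
  simp [unaryCode, List.replicate_succ]

/-- Register `3` serves as a flag that keeps the loop running; it is popped when the terminating
`false` is met. -/
theorem emits_readCount {ρ : Store} {s c k : ℕ} {l : List Bool} (hs : s ≠ 0) (hc : c ≠ 0)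
    (hsc : s ≠ c) (hs3 : s ≠ 3) (hc3 : c ≠ 3) (h : ρ s = unaryCode k ++ l) (h3 : ρ 3 = []) :
    Emits ρ (Function.update (Function.update ρ s l) c (ones k ++ ρ c)) (readCount s c)
      (4 * k + 6) [] := by
  have key : ∀ (k : ℕ) (ρ : Store), ρ s = unaryCode k ++ l → ρ 3 = [true] →
      Emits ρ (Function.update (Function.update (Function.update ρ 3 []) s l) c (ones k ++ ρ c))
        (Prog.loop 3 (Prog.branch s Prog.skip (Prog.pop s ⨾ Prog.pop 3)
          (Prog.pop s ⨾ Prog.push c true))) (4 * k + 5) [] := by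
    intro k
    induction k with
    | zero =>
      intro ρ h h3
      refine (Emits.loop_step (by omega) (by simp [h3])
        (Emits.branch_cons (b := false) (l := l) hs (by simpa [unaryCode] using h)
          ((Emits.pop hs _).seq (Emits.pop (by omega) _)))
        (Emits.loop_done (by omega) (by simp [hs3.symm, h3]))).congr ?_ (by omega) rfl
      funext x; simp only [Function.update_apply]
      split_ifs <;> simp_all [unaryCode]
    | succ k ih =>
      intro ρ h h3
      rw [unaryCode_succ, List.cons_append] at h
      refine (Emits.loop_step (by omega) (by simp [h3])
        (Emits.branch_cons (b := true) (l := unaryCode k ++ l) hs h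
          ((Emits.pop hs _).seq (Emits.push hc _ true)))
        (ih _ ?_ ?_)).congr ?_ (by omega) rfl
      · simp [hsc, h]
      · simp [hs3.symm, hc3.symm, h3]
      · funext x; simp only [Function.update_apply]
        split_ifs <;> simp_all [List.replicate_succ']
  refine ((Emits.push (by omega) ρ true).seq (key k _ ?_ ?_)).congr ?_ (by omega) rfl
  · simp [hs3, h]
  · simp [h3]
  · funext x; simp only [Function.update_apply]
    split_ifs <;> simp_all

/-- Reverse the contents of the register `r` onto the register `s`. -/
def moveBits (r s : ℕ) : Prog :=
  Prog.loop r (Prog.branch r Prog.skip (Prog.pop r ⨾ Prog.push s false)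
    (Prog.pop r ⨾ Prog.push s true))

theorem exec_moveBits {r s : ℕ} (hrs : r ≠ s) (l : List Bool) (σ : Store) (h : σ r = l) :
    Exec (moveBits r s) σ [] (4 * l.length + 1)
      (Function.update (Function.update σ r []) s (l.reverse ++ σ s)) := by
  induction l generalizing σ with
  | nil =>
    have : Function.update (Function.update σ r []) s ([].reverse ++ σ s) = σ := by
      funext x; simp only [Function.update_apply]; split_ifs <;> simp_all
    rw [this]
    exact Exec.loopDone h
  | cons b l ih =>
    have h₁ := (Exec.pop r σ).seq (Exec.push s b _)
    have h₂ := ih (Function.update (Function.update σ r (σ r).tail) s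
      (b :: (Function.update σ r (σ r).tail) s)) (by simp [hrs, h])
    have h₃ : Exec (Prog.branch r Prog.skip (Prog.pop r ⨾ Prog.push s false)
        (Prog.pop r ⨾ Prog.push s true)) σ ([] ++ []) (1 + 1 + 1)
        (Function.update (Function.update σ r (σ r).tail) s
          (b :: (Function.update σ r (σ r).tail) s)) := by
      cases b with
      | false => exact Exec.branchFalse (by simp [h]) h₁
      | true => exact Exec.branchTrue (by simp [h]) h₁
    have h₄ := Exec.loopStep (by simp [h]) h₃ h₂
    rw [List.append_nil, List.append_nil] at h₄
    convert h₄ using 1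
    · rfl
    · simp only [List.length_cons]; omega
    · funext x; simp only [Function.update_apply]; split_ifs <;> simp_all

/-! ### The circuits -/

/-- The TOFFOLI with controls `q + 1`, `q + 2` and target `q`, if these wires exist. -/
def towerGate (N q : ℕ) : QCircuit N :=
  if h : q + 2 < N then
    [QGate.toffoli ⟨q + 1, by omega⟩ ⟨q + 2, h⟩ ⟨q, by omega⟩ (by simp) (by simp) (by simp)]
  else []

/-- The gates `towerGate` at `q, q + 2, …, q + 2 k`, and back to `q`. -/
def ladder (N q k : ℕ) : QCircuit N :=
  (List.range k).flatMap (fun j => towerGate N (q + 2 * j)) ++ (towerGate N (q + 2 * k) ++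
    (List.range k).reverse.flatMap (fun j => towerGate N (q + 2 * j)))

/-- One of the two equal halves of `allOnesFlip`. -/
def allOnesHalf (w : ℕ) : QCircuit (w + 2) :=
  ladder (w + 2) 1 (w / 2 - 2 + 1) ++ (ladder (w + 2) 3 (w / 2 - 2) ++
    (ladder (w + 2) 0 ((w + 1) / 2 - 2 + 1) ++ ladder (w + 2) 2 ((w + 1) / 2 - 2)))

/-- For `4 ≤ w`, this flips qubit `0` if and only if the qubits from `2` on are all `1`; qubit `1`
is borrowed. -/
def allOnesFlip (w : ℕ) : QCircuit (w + 2) := allOnesHalf w ++ allOnesHalf w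

/-- A reversible gate, acting on the qubits from `2` on. -/
def RevGate.lift {w : ℕ} : RevGate w → QGate (w + 2)
  | .not i => .x i.succ.succ
  | .toffoli i j k hij hik hjk =>
    .toffoli i.succ.succ j.succ.succ k.succ.succ (by simpa using hij) (by simpa using hik)
      (by simpa using hjk)

/-- Hadamard gates on the input bits and NOT gates on the ancilla bits. -/
def inputLayer (n ξ : ℕ) : QCircuit (n + ξ + 2) :=
  ((List.finRange ξ).map fun i => (QGate.x (i.natAdd n).succ.succ : QGate (n + ξ + 2))).reverse ++
    ((List.finRange n).map fun i => (QGate.h (i.castAdd ξ).succ.succ : QGate (n + ξ + 2))).reverse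

/-- The controlled phase on qubit `1` and the last qubit. -/
def lastPhase (w : ℕ) (hw : 0 < w) : QCircuit (w + 2) :=
  [.h 1, .cnot (Fin.last (w + 1)) 1 (by simp [Fin.ext_iff]; omega), .h 1]

def swapFirst (w : ℕ) : QCircuit (w + 2) :=
  [.cnot 0 1 (by simp), .cnot 1 0 (by simp), .cnot 0 1 (by simp)]

/-- Flip the first data qubit if qubit `1` is `0`. -/
def offFlip (w : ℕ) (hw : 0 < w) : QCircuit (w + 2) :=
  [.cnot 1 ⟨2, by omega⟩ (by simp [Fin.ext_iff]), .x ⟨2, by omega⟩]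

/-- The part of `gapCircuit` that depends on the reversible circuit. -/
def phaseBlock {n ξ : ℕ} (hn : 0 < n + ξ) (C : RevCircuit (n + ξ)) : QCircuit (n + ξ + 2) :=
  inputLayer n ξ ++ (C.map RevGate.lift ++ (lastPhase (n + ξ) hn ++
    (C.reverse.map RevGate.lift ++ inputLayer n ξ)))

/-- A circuit for the one-clean-qubit model that accepts with nonzero probability if and only if
the gap of `C` is nonzero. -/
def gapCircuit {n ξ : ℕ} (hn : 0 < n + ξ) (C : RevCircuit (n + ξ)) : QCircuit (n + ξ + 2) :=
  allOnesFlip (n + ξ) ++ (offFlip (n + ξ) hn ++ (phaseBlock hn C ++ (swapFirst (n + ξ) ++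
    (allOnesFlip (n + ξ) ++ (swapFirst (n + ξ) ++ (phaseBlock hn C ++ (offFlip (n + ξ) hn ++
      (allOnesFlip (n + ξ) ++ [.x 0]))))))))

/-- The concatenated codes of the gates of a circuit. -/
abbrev gateCodes {N : ℕ} (U : QCircuit N) : List Bool := U.flatMap QGate.code

theorem gateCodes_append {N : ℕ} (U V : QCircuit N) :
    gateCodes (U ++ V) = gateCodes U ++ gateCodes V := List.flatMap_append

/-! ### A program that writes the description of the circuit -/

/-- Emit the unary code of the number in register `11` increased by `c`. -/
def emitIndex (c : ℕ) : Prog :=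
  Prog.push 0 false ⨾ emitCount 11 12 ⨾ pushAll 0 (ones c).reverse

theorem emits_emitIndex {ρ : Store} {q : ℕ} (c : ℕ) (hq : ρ 11 = ones q) (ht : ρ 12 = []) :
    Emits ρ ρ (emitIndex c) (7 * q + c + 4) (unaryCode (q + c)) := by
  refine ((Emits.push_out ρ false).seq ((emits_emitCount (by decide) (by decide) (by decide)
    hq ht).seq (Emits.pushAll_out ρ (ones c)))).congr rfl (by simp; omega) ?_
  rw [unaryCode, add_comm, List.replicate_add]

def emitTower : Prog :=
  emitIndex 0 ⨾ emitIndex 2 ⨾ emitIndex 1 ⨾ pushAll 0 (unaryCode 4).reverse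

theorem emits_emitTower {ρ : Store} {N q : ℕ} (hN : q + 2 < N) (hq : ρ 11 = ones q)
    (ht : ρ 12 = []) :
    Emits ρ ρ emitTower (21 * q + 21) (gateCodes (towerGate N q)) := by
  refine ((emits_emitIndex 0 hq ht).seq ((emits_emitIndex 2 hq ht).seq
    ((emits_emitIndex 1 hq ht).seq (Emits.pushAll_out ρ (unaryCode 4))))).congr rfl
    (by simp [unaryCode]; omega) ?_
  simp [towerGate, hN, gateCodes, QGate.code]

/-- Used for the second loop of `emitLadder`, which visits the gates in descending order; the stack
reverses them once more. -/
theorem flatMap_reverse_range {α : Type*} (k : ℕ) (g : ℕ → List α) :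
    (List.range k).reverse.flatMap (fun i => g (k - 1 - i)) = (List.range k).flatMap g := by
  have : (List.range k).reverse.map (fun i => k - 1 - i) = List.range k := by
    refine List.ext_getElem (by simp) fun i h₁ h₂ => ?_
    simp at h₁
    simp
    omega
  conv_rhs => rw [← this, List.flatMap_map]

/-- Emit a ladder; the register `11` holds its first target, and `r` its length. -/
def emitLadder (r : ℕ) : Prog :=
  Prog.loop r (Prog.pop r ⨾ Prog.push 15 true ⨾ emitTower ⨾ Prog.push 11 true ⨾
    Prog.push 11 true) ⨾ emitTower ⨾
  Prog.loop 15 (Prog.pop 15 ⨾ Prog.push r true ⨾ Prog.pop 11 ⨾ Prog.pop 11 ⨾ emitTower)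

theorem emits_emitLadder {ρ : Store} {N q k r : ℕ} (hN : q + 2 * k + 2 < N) (hr : r ≠ 0)
    (hr11 : r ≠ 11) (hr12 : r ≠ 12) (hr15 : r ≠ 15) (hq : ρ 11 = ones q)
    (ht : ρ 12 = []) (ht' : ρ 15 = []) (hk : ρ r = ones k) :
    Emits ρ ρ (emitLadder r) (100 * (N + 1) * (N + 1)) (gateCodes (ladder N q k)) := by
  -- The store after `i` gates of the first loop: `r` counts down, register `15` counts up, register
  -- `11` holds the current target. The second loop runs through the same stores backwards.
  set f : ℕ → Store := fun i => Function.update (Function.update (Function.update ρ r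
    (ones (k - i))) 15 (ones i)) 11 (ones (q + 2 * i)) with hf
  have hf0 : f 0 = ρ := by
    funext x; simp only [hf, Function.update_apply]; split_ifs <;> simp_all
  have hf11 : ∀ i, f i 11 = ones (q + 2 * i) := by intro i; simp [hf]
  have hf12 : ∀ i, f i 12 = [] := by intro i; simp [hf, hr12.symm, ht]
  have hf15 : ∀ i, f i 15 = ones i := by intro i; simp [hf]
  have hfr : ∀ i, f i r = ones (k - i) := by intro i; simp [hf, hr11, hr15]
  have h₁ : Emits (f 0) (f k) (Prog.loop r (Prog.pop r ⨾ Prog.push 15 true ⨾ emitTower ⨾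
      Prog.push 11 true ⨾ Prog.push 11 true)) (k * (21 * N + 25 + 1) + 1)
      ((List.range k).reverse.flatMap fun i => gateCodes (towerGate N (q + 2 * i))) := by
    refine Emits.loop hr f _ k (fun i hi => ?_) (fun i hi => ?_) ?_
    · rw [hfr]; simp; omega
    · refine ((Emits.pop hr _).seq ((Emits.push (by decide) _ true).seq
        ((emits_emitTower (N := N) (q := q + 2 * i) (by omega) ?_ ?_).seq
          ((Emits.push (by decide) _ true).seq (Emits.push (by decide) _ true))))).congr
          ?_ (by omega) (by simp)
      · simp [hr11.symm, hf11]
      · simp [hr12.symm, hf12]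
      · obtain ⟨j, hj⟩ : ∃ j, k - i = j + 1 := ⟨k - i - 1, by omega⟩
        have hj' : k - (i + 1) = j := by omega
        have e : q + 2 * (i + 1) = q + 2 * i + 1 + 1 := by ring
        funext x; simp only [hf, Function.update_apply, hj, hj', e]
        clear hf0 hf11 hf12 hf15 hfr hf f e
        clear hj hj' hN hk
        by_cases h11 : x = 11
        · simp [h11, hr11.symm, List.replicate_succ]
        by_cases h15 : x = 15
        · simp [h15, hr15.symm, List.replicate_succ]
        by_cases hxr : x = r
        · simp [hxr, hr11, hr15, List.replicate_succ]
        · simp [h11, h15, hxr]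
    · rw [hfr]; simp
  have h₂ : Emits (f k) (f k) emitTower (21 * N + 21) (gateCodes (towerGate N (q + 2 * k))) :=
    (emits_emitTower hN (hf11 k) (hf12 k)).congr rfl (by omega) rfl
  have h₃ : Emits (f k) (f 0) (Prog.loop 15 (Prog.pop 15 ⨾ Prog.push r true ⨾ Prog.pop 11 ⨾
      Prog.pop 11 ⨾ emitTower)) (k * (21 * N + 25 + 1) + 1)
      ((List.range k).flatMap fun i => gateCodes (towerGate N (q + 2 * i))) := by
    have := Emits.loop (P := Prog.pop 15 ⨾ Prog.push r true ⨾ Prog.pop 11 ⨾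
      Prog.pop 11 ⨾ emitTower) (T := 21 * N + 25) (r := 15) (by decide) (fun i => f (k - i))
      (fun i => gateCodes (towerGate N (q + 2 * (k - 1 - i)))) k
      (fun i hi => ?_) (fun i hi => ?_) ?_
    · simp only [Nat.sub_zero, Nat.sub_self] at this
      refine this.congr rfl le_rfl ?_
      exact flatMap_reverse_range k fun i => gateCodes (towerGate N (q + 2 * i))
    · simp only [hf15]; simp; omega
    · obtain ⟨j, hj⟩ : ∃ j, k - i = j + 1 := ⟨k - i - 1, by omega⟩
      have hj' : k - (i + 1) = j := by omega
      have hj'' : k - 1 - i = j := by omega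
      simp only [hj, hj', hj'']
      have hE : Function.update (Function.update (Function.update (Function.update (f (j + 1))
          15 (ones j)) r (ones (k - j))) 11 (ones (q + 2 * j + 1))) 11 (ones (q + 2 * j))
          = f j := by
        funext x; simp only [hf, Function.update_apply]
        split_ifs <;> simp_all
      have a₁ := Emits.pop (r := 15) (by decide) (f (j + 1))
      have a₂ := Emits.push hr (Function.update (f (j + 1)) 15 (ones j)) true
      have a₃ := Emits.pop (r := 11) (by decide) (Function.update (Function.update (f (j + 1))
          15 (ones j)) r (ones (k - j)))
      have a₄ := Emits.pop (r := 11) (by decide) (Function.update (Function.update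
        (Function.update (f (j + 1)) 15 (ones j)) r (ones (k - j))) 11 (ones (q + 2 * j + 1)))
      have b₁ : (f (j + 1) 15).tail = ones j := by simp [hf15, List.replicate_succ]
      have b₂ : true :: Function.update (f (j + 1)) 15 (ones j) r = ones (k - j) := by
        rw [Function.update_of_ne hr15, hfr, ← List.replicate_succ]
        congr 1; omega
      have b₃ : (Function.update (Function.update (f (j + 1)) 15 (ones j)) r
          (ones (k - j)) 11).tail = ones (q + 2 * j + 1) := by
        rw [Function.update_of_ne hr11.symm, Function.update_of_ne (by decide), hf11,
          show q + 2 * (j + 1) = q + 2 * j + 1 + 1 by ring, ones, List.replicate_succ,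
          List.tail_cons]
      have b₄ : (Function.update (Function.update (Function.update (f (j + 1)) 15 (ones j)) r
          (ones (k - j))) 11 (ones (q + 2 * j + 1)) 11).tail = ones (q + 2 * j) := by
        simp [List.replicate_succ]
      rw [b₁] at a₁
      rw [b₂] at a₂
      rw [b₃] at a₃
      rw [b₄, hE] at a₄
      exact (a₁.seq (a₂.seq (a₃.seq (a₄.seq (emits_emitTower (N := N) (by omega) (hf11 j)
        (hf12 j)))))).congr rfl (by omega) (by simp)
    · simp [hf15]
  rw [hf0] at h₁ h₃
  refine (h₁.seq (h₂.seq h₃)).congr rfl ?_ ?_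
  · have : k ≤ N := by omega
    nlinarith [Nat.mul_le_mul this (le_refl (21 * N + 26))]
  · simp [ladder, gateCodes, List.flatMap_append, List.flatMap_assoc]

/-- Emit two ladders that together flip the qubit given by register `11`. -/
def emitFlip (r : ℕ) : Prog :=
  Prog.push 11 true ⨾ Prog.push 11 true ⨾ emitLadder r ⨾
  Prog.pop 11 ⨾ Prog.pop 11 ⨾ Prog.push r true ⨾ emitLadder r ⨾ Prog.pop r

/-- The ladder from `q + 2` comes second in the circuit and is therefore emitted first. -/
theorem emits_emitFlip {ρ : Store} {N q k r : ℕ} (hN : q + 2 * k + 4 < N) (hr : r ≠ 0)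
    (hr11 : r ≠ 11) (hr12 : r ≠ 12) (hr15 : r ≠ 15) (hq : ρ 11 = ones q)
    (ht : ρ 12 = []) (ht' : ρ 15 = []) (hk : ρ r = ones k) :
    Emits ρ ρ (emitFlip r) (200 * (N + 1) * (N + 1) + 6)
      (gateCodes (ladder N q (k + 1)) ++ gateCodes (ladder N (q + 2) k)) := by
  refine ((Emits.push (by decide) _ true).seq ((Emits.push (by decide) _ true).seq
    ((emits_emitLadder (N := N) (q := q + 2) (k := k) (by omega) hr hr11 hr12 hr15
      ?_ ?_ ?_ ?_).seq
    ((Emits.pop (by decide) _).seq ((Emits.pop (by decide) _).seq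
    ((Emits.push hr _ true).seq
    ((emits_emitLadder (N := N) (q := q) (k := k + 1) (by omega) hr hr11 hr12 hr15
      ?_ ?_ ?_ ?_).seq
    (Emits.pop hr _)))))))).congr ?_ ?_ ?_
  · simp [hq, List.replicate_succ]
  · simp [ht]
  · simp [ht']
  · simp [hr11, hk]
  · simp [hr11.symm, hq]
  · simp [hr12.symm, ht]
  · simp [hr15.symm, ht']
  · simp [hr11, hk, List.replicate_succ]
  · funext x; simp only [Function.update_apply]
    split_ifs <;> simp_all
  · linarith
  · simp only [List.append_nil, List.nil_append]

def emitAllOnesHalf : Prog :=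
  emitFlip 13 ⨾ Prog.push 11 true ⨾ emitFlip 14 ⨾ Prog.pop 11

theorem emits_emitAllOnesHalf {ρ : Store} {w : ℕ} (hw : 4 ≤ w) (hq : ρ 11 = [])
    (ht : ρ 12 = []) (ht' : ρ 15 = []) (h₀ : ρ 13 = ones ((w + 1) / 2 - 2))
    (h₁ : ρ 14 = ones (w / 2 - 2)) :
    Emits ρ ρ emitAllOnesHalf (400 * (w + 3) * (w + 3) + 14) (gateCodes (allOnesHalf w)) := by
  refine ((emits_emitFlip (N := w + 2) (q := 0) (k := (w + 1) / 2 - 2) (r := 13) (by omega)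
      (by decide) (by decide) (by decide) (by decide) hq ht ht' h₀).seq
    ((Emits.push (by decide) _ true).seq
    ((emits_emitFlip (N := w + 2) (q := 1) (k := w / 2 - 2) (r := 14) (by omega)
      (by decide) (by decide) (by decide) (by decide) ?_ ?_ ?_ ?_).seq
    (Emits.pop (by decide) _)))).congr ?_ ?_ ?_
  · simp [hq]
  · simp [ht]
  · simp [ht']
  · simp [h₁]
  · funext x; simp only [Function.update_apply]
    split_ifs <;> simp_all
  · linarith
  · simp only [allOnesHalf, gateCodes_append, List.append_nil, List.nil_append, List.append_assoc,
      Nat.zero_add, Nat.reduceAdd]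

def emitAllOnes : Prog := emitAllOnesHalf ⨾ emitAllOnesHalf

theorem emits_emitAllOnes {ρ : Store} {w : ℕ} (hw : 4 ≤ w) (hq : ρ 11 = [])
    (ht : ρ 12 = []) (ht' : ρ 15 = []) (h₀ : ρ 13 = ones ((w + 1) / 2 - 2))
    (h₁ : ρ 14 = ones (w / 2 - 2)) :
    Emits ρ ρ emitAllOnes (800 * (w + 3) * (w + 3) + 28) (gateCodes (allOnesFlip w)) := by
  have h := emits_emitAllOnesHalf hw hq ht ht' h₀ h₁
  refine (h.seq h).congr rfl ?_ ?_
  · linarith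
  · rw [allOnesFlip, gateCodes_append]

/-- Emit a gate with code `g` for each of the consecutive wires from the one in register `11` on;
their number is moved from `r` to `s`. -/
def emitRow (r s g : ℕ) : Prog :=
  Prog.loop r (Prog.pop r ⨾ Prog.push s true ⨾ emitIndex 0 ⨾ pushAll 0 (unaryCode g).reverse ⨾
    Prog.push 11 true)

theorem emits_emitRow {r s : ℕ} (g m : ℕ) (hr : r ≠ 0) (hs : s ≠ 0) (hrs : r ≠ s) (hr11 : r ≠ 11)
    (hs11 : s ≠ 11) (hr12 : r ≠ 12) (hs12 : s ≠ 12) (k : ℕ) :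
    ∀ {ρ : Store} {q : ℕ}, q + k ≤ m → ρ r = ones k → ρ 11 = ones q → ρ 12 = [] →
    Emits ρ (Function.update (Function.update (Function.update ρ r []) s (ones k ++ ρ s))
      11 (ones (q + k))) (emitRow r s g) (k * (7 * m + g + 10) + 1)
      ((List.range k).reverse.flatMap fun i => unaryCode g ++ unaryCode (q + i)) := by
  induction k with
  | zero =>
    intro ρ q hm h hq ht
    refine (Emits.loop_done hr h).congr ?_ (by omega) rfl
    funext x; simp only [Function.update_apply]; split_ifs <;> simp_all
  | succ k ih =>
    intro ρ q hm h hq ht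
    refine (Emits.loop_step hr (by simp [h, List.replicate_succ])
      ((Emits.pop hr ρ).seq ((Emits.push hs _ true).seq
        ((emits_emitIndex (q := q) 0 ?_ ?_).seq ((Emits.pushAll_out _ (unaryCode g)).seq
          (Emits.push (by decide) _ true)))))
      (ih (q := q + 1) (by omega) ?_ ?_ ?_)).congr ?_ ?_ ?_
    · simp [hr11.symm, hs11.symm, hq]
    · simp [hr12.symm, hs12.symm, ht]
    · simp [hr11, hrs, h]
    · simp [hr11.symm, hs11.symm, hq, List.replicate_succ]
    · simp [hr12.symm, hs12.symm, ht]
    · clear ih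
      rw [show q + 1 + k = q + (k + 1) by ring]
      funext x; simp only [Function.update_apply]
      split_ifs <;> simp_all [List.replicate_succ']
    · simp only [unaryCode, List.length_append, List.length_replicate, List.length_singleton]
      nlinarith
    · rw [List.range_succ_eq_map]
      simp [List.flatMap_map, ← List.map_reverse, add_comm, add_left_comm]

def emitInputLayer : Prog :=
  Prog.push 11 true ⨾ Prog.push 11 true ⨾ emitRow 7 9 1 ⨾ emitRow 8 10 0 ⨾ moveCount 9 7 ⨾
    moveCount 10 8 ⨾ clear 11

theorem flatMap_reverse_finRange {α : Type*} (k : ℕ) (g : ℕ → List α) :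
    (List.finRange k).reverse.flatMap (fun i => g i.val) =
      (List.range k).reverse.flatMap g := by
  rw [← List.map_coe_finRange_eq_range, ← List.map_reverse, List.flatMap_map]

theorem emits_emitInputLayer {ρ : Store} {n ξ : ℕ} (hn : ρ 7 = ones n) (hξ : ρ 8 = ones ξ)
    (h9 : ρ 9 = []) (h10 : ρ 10 = []) (hq : ρ 11 = []) (ht : ρ 12 = []) :
    Emits ρ ρ emitInputLayer (100 * (n + ξ + 3) * (n + ξ + 3)) (gateCodes (inputLayer n ξ)) := by
  refine ((Emits.push (by decide) _ true).seq ((Emits.push (by decide) _ true).seq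
    ((emits_emitRow (r := 7) (s := 9) 1 (n + ξ + 2) (by decide) (by decide) (by decide)
      (by decide) (by decide) (by decide) (by decide) n (q := 2) (by omega) ?_ ?_ ?_).seq
    ((emits_emitRow (r := 8) (s := 10) 0 (n + ξ + 2) (by decide) (by decide) (by decide)
      (by decide) (by decide) (by decide) (by decide) ξ (q := 2 + n) (by omega) ?_ ?_ ?_).seq
    ((emits_moveCount (r := 9) (s := 7) (k := n) (by decide) (by decide) (by decide) ?_).seq
    ((emits_moveCount (r := 10) (s := 8) (k := ξ) (by decide) (by decide) (by decide) ?_).seq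
    (emits_clear (r := 11) (l := ones (2 + n + ξ)) (by decide) ?_))))))).congr ?_ ?_ ?_
  · simp [hn]
  · simp [hq]
    rfl
  · simp [ht]
  · simp [hξ]
  · simp
  · simp [ht]
  · simp [h9]
  · simp [h10]
  · simp
  · funext x
    by_cases h7 : x = 7
    · simp [h7, hn]
    by_cases h8 : x = 8
    · simp [h8, hξ]
    by_cases h9' : x = 9
    · simp [h9', h9]
    by_cases h10' : x = 10
    · simp [h10', h10]
    by_cases h11 : x = 11
    · simp [h11, hq]
    · simp [h7, h8, h9', h10', h11]
  · simp only [List.length_replicate]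
    linarith [Nat.zero_le (n * n), Nat.zero_le (ξ * ξ), Nat.zero_le (n * ξ)]
  · have e₁ : (gateCodes ((List.finRange ξ).map fun i =>
        (QGate.x (i.natAdd n).succ.succ : QGate (n + ξ + 2))).reverse) =
        (List.range ξ).reverse.flatMap fun i => unaryCode 0 ++ unaryCode (2 + n + i) := by
      rw [← flatMap_reverse_finRange, gateCodes, ← List.map_reverse, List.flatMap_map]
      refine congrArg (fun f => List.flatMap f _) (funext fun i => ?_)
      simp only [QGate.code, Fin.val_succ, Fin.val_natAdd]
      congr 2; omega
    have e₂ : (gateCodes ((List.finRange n).map fun i =>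
        (QGate.h (i.castAdd ξ).succ.succ : QGate (n + ξ + 2))).reverse) =
        (List.range n).reverse.flatMap fun i => unaryCode 1 ++ unaryCode (2 + i) := by
      rw [← flatMap_reverse_finRange, gateCodes, ← List.map_reverse, List.flatMap_map]
      refine congrArg (fun f => List.flatMap f _) (funext fun i => ?_)
      simp only [QGate.code, Fin.val_succ, Fin.val_castAdd]
      congr 2; omega
    rw [inputLayer, gateCodes_append, e₁, e₂]
    simp only [List.append_nil, List.nil_append]

def emitLastPhase : Prog :=
  pushAll 0 (unaryCode 1 ++ unaryCode 1).reverse ⨾ pushAll 0 (unaryCode 1).reverse ⨾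
    Prog.push 0 false ⨾ emitCount 7 12 ⨾ emitCount 8 12 ⨾ Prog.push 0 true ⨾
    pushAll 0 (unaryCode 3).reverse ⨾ pushAll 0 (unaryCode 1 ++ unaryCode 1).reverse

theorem emits_emitLastPhase {ρ : Store} {n ξ : ℕ} (hw : 0 < n + ξ) (hn : ρ 7 = ones n)
    (hξ : ρ 8 = ones ξ) (ht : ρ 12 = []) :
    Emits ρ ρ emitLastPhase (7 * (n + ξ) + 40) (gateCodes (lastPhase (n + ξ) hw)) := by
  refine ((Emits.pushAll_out ρ _).seq ((Emits.pushAll_out ρ _).seq ((Emits.push_out ρ false).seq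
    ((emits_emitCount (by decide) (by decide) (by decide) hn ht).seq
    ((emits_emitCount (by decide) (by decide) (by decide) hξ ht).seq
    ((Emits.push_out ρ true).seq ((Emits.pushAll_out ρ _).seq
    (Emits.pushAll_out ρ _)))))))).congr rfl ?_ ?_
  · simp [unaryCode]
    omega
  · have : unaryCode (n + ξ + 1) = true :: (ones ξ ++ (ones n ++ [false])) := by
      rw [unaryCode_succ, unaryCode, add_comm n, List.replicate_add, List.append_assoc]
    simp [lastPhase, gateCodes, QGate.code, this, -List.replicate_append_replicate]

/-- Emit the number in `c`, increased by `2`, in unary code, moving it to the top of `d`. -/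
def emitMove (c d : ℕ) : Prog :=
  Prog.push 0 false ⨾ Prog.push d false ⨾ dupCount c d 0 ⨾ pushAll 0 (ones 2).reverse

/-- The shift by `2` is that of `RevGate.lift`; the copy in `d` keeps the original index, so that
the gate can be read again. -/
theorem emits_emitMove {ρ : Store} {c d k : ℕ} (hc : c ≠ 0) (hd : d ≠ 0) (hcd : c ≠ d)
    (h : ρ c = ones k) :
    Emits ρ (Function.update (Function.update ρ c []) d (unaryCode k ++ ρ d)) (emitMove c d)
      (4 * k + 6) (unaryCode (k + 2)) := by
  refine ((Emits.push_out ρ false).seq ((Emits.push hd _ false).seq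
    ((emits_dupCount_out (k := k) hc hd hcd ?_).seq (Emits.pushAll_out _ (ones 2))))).congr
    ?_ (by simp; omega) ?_
  · simp [hcd, h]
  · funext x; simp only [Function.update_apply]
    split_ifs <;> simp_all [unaryCode]
  · simp [unaryCode_succ, List.replicate_succ]
    simp [unaryCode]

/-- Move a gate of a reversible circuit from `s` to `d`, emitting the corresponding quantum gate. -/
def transferGate (s d : ℕ) : Prog :=
  Prog.branch s Prog.skip
    (Prog.pop s ⨾ readCount s 6 ⨾ emitMove 6 d ⨾ pushAll 0 (unaryCode 0).reverse ⨾
      Prog.push d false)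
    (Prog.pop s ⨾ Prog.pop s ⨾ readCount s 4 ⨾ readCount s 5 ⨾ readCount s 6 ⨾
      emitMove 6 d ⨾ emitMove 5 d ⨾ emitMove 4 d ⨾ pushAll 0 (unaryCode 4).reverse ⨾
      Prog.push d false ⨾ Prog.push d true)

/-- The indices of a TOFFOLI are read in the order `i`, `j`, `k` and written in the opposite order,
so on both target stacks the code of the gate reads correctly. -/
theorem emits_transferGate {ρ : Store} {s d w : ℕ} (g : RevGate w) {l : List Bool}
    (hs : s = 1 ∨ s = 2) (hd : d = 1 ∨ d = 2) (hsd : s ≠ d)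
    (h : ρ s = g.code ++ l) (h3 : ρ 3 = []) (h4 : ρ 4 = []) (h5 : ρ 5 = []) (h6 : ρ 6 = []) :
    Emits ρ (Function.update (Function.update ρ s l) d (g.code ++ ρ d)) (transferGate s d)
      (24 * w + 60) g.lift.code := by
  have hs0 : s ≠ 0 := by omega
  have hd0 : d ≠ 0 := by omega
  have s3 : s ≠ 3 := by omega
  have s4 : s ≠ 4 := by omega
  have s5 : s ≠ 5 := by omega
  have s6 : s ≠ 6 := by omega
  have d3 : d ≠ 3 := by omega
  have d4 : d ≠ 4 := by omega
  have d5 : d ≠ 5 := by omega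
  have d6 : d ≠ 6 := by omega
  clear hs hd
  cases g with
  | not i =>
    refine (Emits.branch_cons (b := false) (l := unaryCode i ++ l) hs0
      (by simpa [RevGate.code, unaryCode] using h)
      ((Emits.pop hs0 _).seq
      ((emits_readCount (k := i) (l := l) hs0 (by decide) s6 s3 (by decide) ?_ ?_).seq
      ((emits_emitMove (k := i) (by decide) hd0 d6.symm ?_).seq
      ((Emits.pushAll_out _ (unaryCode 0)).seq (Emits.push hd0 _ false)))))).congr ?_ ?_ ?_
    · simp [h, RevGate.code, unaryCode]
    · simp [s3.symm, h3]
    · simp [s6.symm, h6]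
    · funext x; simp only [Function.update_apply]
      split_ifs <;> simp_all [RevGate.code, unaryCode]
    · have := i.isLt
      simp [unaryCode]
      omega
    · simp [RevGate.lift, QGate.code]
  | toffoli i j k hij hik hjk =>
    refine (Emits.branch_cons (b := true)
      (l := false :: (unaryCode i ++ (unaryCode j ++ (unaryCode k ++ l)))) hs0
      (by simpa [RevGate.code, unaryCode] using h)
      ((Emits.pop hs0 _).seq ((Emits.pop hs0 _).seq
      ((emits_readCount (k := i) (l := unaryCode j ++ (unaryCode k ++ l)) hs0 (by decide) s4 s3
        (by decide) ?_ ?_).seq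
      ((emits_readCount (k := j) (l := unaryCode k ++ l) hs0 (by decide) s5 s3
        (by decide) ?_ ?_).seq
      ((emits_readCount (k := k) (l := l) hs0 (by decide) s6 s3
        (by decide) ?_ ?_).seq
      ((emits_emitMove (k := k) (by decide) hd0 d6.symm ?_).seq
      ((emits_emitMove (k := j) (by decide) hd0 d5.symm ?_).seq
      ((emits_emitMove (k := i) (by decide) hd0 d4.symm ?_).seq
      ((Emits.pushAll_out _ (unaryCode 4)).seq
      ((Emits.push hd0 _ false).seq (Emits.push hd0 _ true)))))))))))).congr ?_ ?_ ?_
    · simp [h, RevGate.code, unaryCode]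
    · simp [s3.symm, h3]
    · simp [s4]
    · simp [s3.symm, h3]
    · simp [s5]
    · simp [s3.symm, h3]
    · simp [s6.symm, h6]
    · simp [s5.symm, d5.symm, h5]
    · simp [s4.symm, d4.symm, h4]
    · funext x
      by_cases hx4 : x = 4
      · simp [hx4, s4.symm, d4.symm, h4]
      by_cases hx5 : x = 5
      · simp [hx5, s5.symm, d5.symm, h5]
      by_cases hx6 : x = 6
      · simp [hx6, s6.symm, d6.symm, h6]
      by_cases hxd : x = d
      · simp [hxd, d4, d5, d6, hsd.symm, RevGate.code, unaryCode_succ]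
        simp [unaryCode]
      by_cases hxs : x = s
      · simp [hxs, s4, s5, s6, hsd]
      · simp [hx4, hx5, hx6, hxd, hxs]
    · have := i.isLt
      have := j.isLt
      have := k.isLt
      simp [unaryCode]
      omega
    · simp [RevGate.lift, QGate.code]

/-- Move a reversible circuit from `s` to `d`, reversing it, and emit the gates. -/
def transfer (s d : ℕ) : Prog := Prog.loop s (transferGate s d)

/-- Gates leave `s` from first to last, hence arrive reversed in `d` and in the output. One transfer
thus emits the inverse of `C`; the transfer back emits `C` and restores the register. -/
theorem emits_transfer {s d w : ℕ} (C : RevCircuit w)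
    (hs : s = 1 ∨ s = 2) (hd : d = 1 ∨ d = 2) (hsd : s ≠ d) :
    ∀ {ρ : Store}, ρ s = C.flatMap RevGate.code → ρ 3 = [] → ρ 4 = [] → ρ 5 = [] → ρ 6 = [] →
    Emits ρ (Function.update (Function.update ρ s []) d
      (C.reverse.flatMap RevGate.code ++ ρ d)) (transfer s d)
      (C.length * (24 * w + 61) + 1) (gateCodes (C.reverse.map RevGate.lift)) := by
  have hs0 : s ≠ 0 := by omega
  induction C with
  | nil =>
    intro ρ h h3 h4 h5 h6
    refine (Emits.loop_done hs0 h).congr ?_ (by simp) rfl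
    funext x; simp only [Function.update_apply]
    split_ifs <;> simp_all
  | cons g C ih =>
    intro ρ h h3 h4 h5 h6
    have s3 : s ≠ 3 := by omega
    have s4 : s ≠ 4 := by omega
    have s5 : s ≠ 5 := by omega
    have s6 : s ≠ 6 := by omega
    have d3 : d ≠ 3 := by omega
    have d4 : d ≠ 4 := by omega
    have d5 : d ≠ 5 := by omega
    have d6 : d ≠ 6 := by omega
    rw [List.flatMap_cons] at h
    refine (Emits.loop_step hs0 (by simp [h, RevGate.code_ne_nil])
      (emits_transferGate g hs hd hsd h h3 h4 h5 h6)
      (ih ?_ ?_ ?_ ?_ ?_)).congr ?_ ?_ ?_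
    · simp [hsd]
    · simp [s3.symm, d3.symm, h3]
    · simp [s4.symm, d4.symm, h4]
    · simp [s5.symm, d5.symm, h5]
    · simp [s6.symm, d6.symm, h6]
    · funext x
      by_cases hxd : x = d
      · simp [hxd]
      by_cases hxs : x = s
      · simp [hxs, hsd]
      · simp [hxd, hxs]
    · rw [List.length_cons, add_mul]
      omega
    · simp [gateCodes]

def emitPhaseBlock : Prog :=
  emitInputLayer ⨾ transfer 1 2 ⨾ emitLastPhase ⨾ transfer 2 1 ⨾ emitInputLayer

theorem emits_emitPhaseBlock {ρ : Store} {n ξ : ℕ} (hw : 0 < n + ξ) (C : RevCircuit (n + ξ))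
    (h1 : ρ 1 = C.flatMap RevGate.code) (h2 : ρ 2 = []) (h3 : ρ 3 = []) (h4 : ρ 4 = [])
    (h5 : ρ 5 = []) (h6 : ρ 6 = []) (hn : ρ 7 = ones n) (hξ : ρ 8 = ones ξ)
    (h9 : ρ 9 = []) (h10 : ρ 10 = []) (hq : ρ 11 = []) (ht : ρ 12 = []) :
    Emits ρ ρ emitPhaseBlock (1000 * (n + ξ + C.length + 3) * (n + ξ + C.length + 3))
      (gateCodes (phaseBlock hw C)) := by
  have h₀ := emits_emitInputLayer hn hξ h9 h10 hq ht
  refine (h₀.seq ((emits_transfer C (s := 1) (d := 2) (by decide) (by decide) (by decide)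
      h1 h3 h4 h5 h6).seq
    ((emits_emitLastPhase (n := n) (ξ := ξ) hw ?_ ?_ ?_).seq
    ((emits_transfer C.reverse (s := 2) (d := 1) (by decide) (by decide) (by decide)
      ?_ ?_ ?_ ?_ ?_).congr (ρ' := ρ) ?_ le_rfl rfl |>.seq h₀)))).congr rfl ?_ ?_
  · simp [hn]
  · simp [hξ]
  · simp [ht]
  · simp [h2]
  · simp [h3]
  · simp [h4]
  · simp [h5]
  · simp [h6]
  · funext x; simp only [Function.update_apply]
    split_ifs <;> simp_all
  · rw [List.length_reverse]
    nlinarith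
  · simp only [phaseBlock, gateCodes_append, List.append_assoc, List.reverse_reverse]

/-! ### The description of the whole circuit -/

def swapCode : List Bool :=
  unaryCode 3 ++ unaryCode 0 ++ unaryCode 1 ++ (unaryCode 3 ++ unaryCode 1 ++ unaryCode 0) ++
    (unaryCode 3 ++ unaryCode 0 ++ unaryCode 1)

theorem gateCodes_swapFirst (w : ℕ) : gateCodes (swapFirst w) = swapCode := by
  simp [gateCodes, swapFirst, swapCode, QGate.code]

def offFlipCode : List Bool :=
  unaryCode 3 ++ unaryCode 1 ++ unaryCode 2 ++ (unaryCode 0 ++ unaryCode 2)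

theorem gateCodes_offFlip (w : ℕ) (hw : 0 < w) : gateCodes (offFlip w hw) = offFlipCode := by
  simp [gateCodes, offFlip, offFlipCode, QGate.code]

def emitGapCircuit : Prog :=
  pushAll 0 (unaryCode 0 ++ unaryCode 0).reverse ⨾ emitAllOnes ⨾ pushAll 0 offFlipCode.reverse ⨾
    emitPhaseBlock ⨾ pushAll 0 swapCode.reverse ⨾ emitAllOnes ⨾ pushAll 0 swapCode.reverse ⨾
    emitPhaseBlock ⨾ pushAll 0 offFlipCode.reverse ⨾ emitAllOnes ⨾
    Prog.push 0 false ⨾ emitCount 7 12 ⨾ emitCount 8 12 ⨾ pushAll 0 (ones 2).reverse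

/-- The contents of the registers while the description of `gapCircuit` is written. -/
def workStore {n ξ : ℕ} (C : RevCircuit (n + ξ)) : Store :=
  Function.update (Function.update (Function.update (Function.update (Function.update
    (fun _ => []) 1 (C.flatMap RevGate.code)) 7 (ones n)) 8 (ones ξ))
    13 (ones ((n + ξ + 1) / 2 - 2))) 14 (ones ((n + ξ) / 2 - 2))

/-- Apart from the final NOT, the sequence of blocks is a palindrome. So backward emission writes
the NOT, then the blocks in circuit order, then the number of qubits. -/
theorem emits_emitGapCircuit {n ξ : ℕ} (hn : 4 ≤ n + ξ) (C : RevCircuit (n + ξ)) :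
    Emits (workStore C) (workStore C) emitGapCircuit
      (5000 * (n + ξ + C.length + 3) * (n + ξ + C.length + 3) + 500)
      (qCode (gapCircuit (by omega) C)) := by
  have hA := emits_emitAllOnes (ρ := workStore C) (w := n + ξ) hn (by simp [workStore])
    (by simp [workStore]) (by simp [workStore]) (by simp [workStore]) (by simp [workStore])
  have hB := emits_emitPhaseBlock (ρ := workStore C) (n := n) (ξ := ξ) (by omega) C
    (by simp [workStore]) (by simp [workStore]) (by simp [workStore]) (by simp [workStore])
    (by simp [workStore]) (by simp [workStore]) (by simp [workStore]) (by simp [workStore])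
    (by simp [workStore]) (by simp [workStore]) (by simp [workStore]) (by simp [workStore])
  have hn7 := emits_emitCount (ρ := workStore C) (r := 7) (s := 12) (k := n) (by decide)
    (by decide) (by decide) (by simp [workStore]) (by simp [workStore])
  have hn8 := emits_emitCount (ρ := workStore C) (r := 8) (s := 12) (k := ξ) (by decide)
    (by decide) (by decide) (by simp [workStore]) (by simp [workStore])
  have hO := Emits.pushAll_out (workStore C) offFlipCode
  have hS := Emits.pushAll_out (workStore C) swapCode
  refine ((Emits.pushAll_out _ (unaryCode 0 ++ unaryCode 0)).seq (hA.seq (hO.seq (hB.seq (hS.seq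
    (hA.seq (hS.seq (hB.seq (hO.seq (hA.seq ((Emits.push_out _ false).seq (hn7.seq (hn8.seq
    (Emits.pushAll_out _ (ones 2))))))))))))))).congr rfl ?_ ?_
  · simp only [offFlipCode, swapCode, unaryCode, List.length_append, List.length_replicate,
      List.length_singleton]
    nlinarith
  · have : unaryCode (n + ξ + 2) = ones 2 ++ (ones ξ ++ (ones n ++ [false])) := by
      rw [unaryCode, add_comm n, add_comm _ 2, List.replicate_add, List.replicate_add,
        List.append_assoc, List.append_assoc]
    rw [qCode, this]
    change _ = _ ++ gateCodes _
    have hx : gateCodes [(QGate.x 0 : QGate (n + ξ + 2))] = unaryCode 0 ++ unaryCode 0 := by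
      simp [gateCodes, QGate.code]
    simp only [gapCircuit, gateCodes_append, gateCodes_swapFirst, gateCodes_offFlip,
      List.append_assoc, hx]

/-! ### Loading the input and clearing the registers -/

def prepare : Prog :=
  readCount 1 7 ⨾ readCount 1 8 ⨾ addCount 7 12 9 ⨾ addCount 8 12 9 ⨾ halve 9 13 14 ⨾
    Prog.pop 13 ⨾ Prog.pop 13 ⨾ Prog.pop 14 ⨾ Prog.pop 14

/-- Popping an empty stack does nothing, so the two final pairs of pops are the truncated
subtractions of `2` in `workStore`. -/
theorem emits_prepare {n ξ : ℕ} (C : RevCircuit (n + ξ)) :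
    Emits (Function.update (fun _ => []) 1 (revCode C)) (workStore C) prepare
      (30 * (n + ξ) + 50) [] := by
  refine ((emits_readCount (s := 1) (c := 7) (k := n) (l := unaryCode ξ ++ C.flatMap RevGate.code)
      (by decide) (by decide) (by decide) (by decide) (by decide) ?_ ?_).seq
    ((emits_readCount (s := 1) (c := 8) (k := ξ) (l := C.flatMap RevGate.code)
      (by decide) (by decide) (by decide) (by decide) (by decide) ?_ ?_).seq
    ((emits_addCount (r := 7) (s := 12) (d := 9) (k := n) (by decide) (by decide) (by decide) (by decide) (by decide)
      (by decide) ?_ ?_).seq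
    ((emits_addCount (r := 8) (s := 12) (d := 9) (k := ξ) (by decide) (by decide) (by decide) (by decide) (by decide)
      (by decide) ?_ ?_).seq
    ((emits_halve (r := 9) (s := 13) (d := 14) (by decide) (by decide) (by decide) (by decide) (by decide)
      (by decide) (n + ξ) ?_).seq
    ((Emits.pop (r := 13) (by decide) _).seq ((Emits.pop (r := 13) (by decide) _).seq
    ((Emits.pop (r := 14) (by decide) _).seq (Emits.pop (r := 14) (by decide) _))))))))).congr ?_ (by omega) rfl
  · simp [revCode]
  · simp
  · simp
  · simp
  · simp
  · simp
  · simp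
  · simp
  · simp [add_comm]
  · funext x
    by_cases hx : x ≤ 14
    · interval_cases x <;> simp [workStore, Nat.sub_sub]
    · have h : ∀ r ≤ 14, x ≠ r := fun r hr hxr => hx (hxr ▸ hr)
      simp [workStore, h]

def cleanUp : Prog := clear 1 ⨾ clear 7 ⨾ clear 8 ⨾ clear 13 ⨾ clear 14

theorem RevGate.code_length_le {w : ℕ} (g : RevGate w) : g.code.length ≤ 3 * w + 2 := by
  cases g with
  | not i => simp [RevGate.code, unaryCode]; omega
  | toffoli i j k => simp [RevGate.code, unaryCode]; omega

theorem flatMap_code_length_le {w : ℕ} (C : RevCircuit w) :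
    (C.flatMap RevGate.code).length ≤ C.length * (3 * w + 2) := by
  induction C with
  | nil => simp
  | cons g C ih =>
    have := g.code_length_le
    rw [List.flatMap_cons, List.length_append, List.length_cons, add_mul]
    omega

theorem emits_cleanUp {n ξ : ℕ} (C : RevCircuit (n + ξ)) :
    Emits (workStore C) (fun _ => []) cleanUp
      (2 * (C.length * (3 * (n + ξ) + 2)) + 8 * (n + ξ) + 10) [] := by
  refine ((emits_clear (l := C.flatMap RevGate.code) (by decide) ?_).seq
    ((emits_clear (l := ones n) (by decide) ?_).seq
    ((emits_clear (l := ones ξ) (by decide) ?_).seq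
    ((emits_clear (l := ones ((n + ξ + 1) / 2 - 2)) (by decide) ?_).seq
    (emits_clear (l := ones ((n + ξ) / 2 - 2)) (by decide) ?_))))).congr ?_ ?_ rfl
  · simp [workStore]
  · simp [workStore]
  · simp [workStore]
  · simp [workStore]
  · simp [workStore]
  · funext x
    simp only [workStore, Function.update_apply]
    split_ifs <;> simp_all
  · have := flatMap_code_length_le C
    simp only [List.length_replicate]
    omega

/-- From the description of a reversible circuit, compute that of `gapCircuit`. -/
def compileGap : Prog :=
  moveBits 0 2 ⨾ moveBits 2 1 ⨾ prepare ⨾ emitGapCircuit ⨾ cleanUp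

theorem revCode_length_le {n ξ : ℕ} (C : RevCircuit (n + ξ)) :
    (revCode C).length ≤ n + ξ + 2 + C.length * (3 * (n + ξ) + 2) := by
  have := flatMap_code_length_le C
  simp only [revCode, unaryCode, List.length_append, List.length_replicate, List.length_singleton]
  omega

/-- The input is moved twice because each move reverses it. The final store is exactly an input
store, so a sampler can be started on it without change. -/
theorem exec_compileGap {n ξ : ℕ} (hn : 4 ≤ n + ξ) (C : RevCircuit (n + ξ)) :
    ∃ t ≤ 6000 * (n + ξ + C.length + 3) * (n + ξ + C.length + 3),
      Exec compileGap (Store.input (revCode C)) [] t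
        (Store.input (qCode (gapCircuit (by omega) C))) := by
  have h₁ := exec_moveBits (r := 0) (s := 2) (by decide) (revCode C) (Store.input (revCode C))
    (Store.input_zero _)
  have e₁ : Function.update (Function.update (Store.input (revCode C)) 0 []) 2
      ((revCode C).reverse ++ Store.input (revCode C) 2) =
      Function.update (fun _ => []) 2 (revCode C).reverse := by
    funext x; simp only [Store.input, Function.update_apply]
    split_ifs <;> simp_all
  rw [e₁] at h₁
  have h₂ := exec_moveBits (r := 2) (s := 1) (by decide) (revCode C).reverse
    (Function.update (fun _ => []) 2 (revCode C).reverse) (by simp)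
  have e₂ : Function.update (Function.update (Function.update (fun _ => []) 2
      (revCode C).reverse) 2 []) 1 ((revCode C).reverse.reverse ++
        Function.update (fun _ => []) 2 (revCode C).reverse 1) =
      Function.update (Function.update (fun _ => []) 1 (revCode C)) 0 [] := by
    funext x; simp only [Function.update_apply]
    split_ifs <;> simp_all
  rw [e₂] at h₂
  obtain ⟨t, ht, h₃⟩ := ((emits_prepare C).seq ((emits_emitGapCircuit hn C).seq
    (emits_cleanUp C))) []
  refine ⟨4 * (revCode C).length + 1 + (4 * (revCode C).reverse.length + 1 + t), ?_,
    h₁.seq (h₂.seq (d := []) ?_)⟩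
  · have := revCode_length_le C
    rw [List.length_reverse]
    nlinarith
  · simpa [Store.input] using h₃

/-! ### Operators of circuits -/

theorem QCircuit.op_nil {N : ℕ} : QCircuit.op ([] : QCircuit N) = 1 := rfl

theorem QCircuit.foldl_op {N : ℕ} (U : QCircuit N) (V : QOp N) :
    List.foldl (fun V g => QGate.op g * V) V U = QCircuit.op U * V := by
  induction U generalizing V with
  | nil => simp [QCircuit.op]
  | cons g U ih => rw [QCircuit.op, List.foldl_cons, List.foldl_cons, ih, ih, mul_one, mul_assoc]

theorem QCircuit.op_cons {N : ℕ} (g : QGate N) (U : QCircuit N) :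
    QCircuit.op (g :: U) = QCircuit.op U * g.op := by
  rw [QCircuit.op, List.foldl_cons, QCircuit.foldl_op, mul_one]

theorem QCircuit.op_append {N : ℕ} (U V : QCircuit N) :
    QCircuit.op (U ++ V) = QCircuit.op V * QCircuit.op U := by
  rw [QCircuit.op, List.foldl_append, QCircuit.foldl_op]
  rfl

theorem QCircuit.op_singleton {N : ℕ} (g : QGate N) : QCircuit.op [g] = g.op := by
  rw [QCircuit.op_cons, QCircuit.op_nil, one_mul]

theorem basisMapOp_id {N : ℕ} : basisMapOp (fun x : Fin N → Bool => x) = 1 := by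
  ext x y
  simp [basisMapOp, Matrix.one_apply]

theorem mul_basisMapOp_apply {N : ℕ} (M : QOp N) (f : (Fin N → Bool) → (Fin N → Bool))
    (x y : Fin N → Bool) : (M * basisMapOp f) x y = M x (f y) := by
  simp [Matrix.mul_apply, basisMapOp]

theorem basisMapOp_mul {N : ℕ} (f g : (Fin N → Bool) → (Fin N → Bool)) :
    basisMapOp f * basisMapOp g = basisMapOp (fun x => f (g x)) := by
  ext x y
  rw [mul_basisMapOp_apply]
  rfl

theorem basisMapOp_mul_apply {N : ℕ} (M : QOp N) {f : (Fin N → Bool) → (Fin N → Bool)}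
    (hf : Function.Involutive f) (x y : Fin N → Bool) : (basisMapOp f * M) x y = M (f x) y := by
  rw [Matrix.mul_apply, Finset.sum_eq_single (f x)]
  · simp [basisMapOp, hf x]
  · intro z _ hz
    have : x ≠ f z := fun h => hz (by rw [h, hf z])
    simp [basisMapOp, this]
  · simp

/-! ### Ladders of TOFFOLI gates -/

/-- The action of `towerGate` on infinite sequences of bits. -/
def towerMap (q : ℕ) (x : ℕ → Bool) : ℕ → Bool :=
  Function.update x q (xor (x q) (x (q + 1) && x (q + 2)))

/-- The action of `ladder` on infinite sequences of bits. -/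
def ladderMap : ℕ → ℕ → (ℕ → Bool) → (ℕ → Bool)
  | q, 0, x => towerMap q x
  | q, k + 1, x => towerMap q (ladderMap (q + 2) k (towerMap q x))

/-- The conjunction of the controls of a ladder. -/
def ladderAnd : ℕ → ℕ → (ℕ → Bool) → Bool
  | q, 0, x => x (q + 1) && x (q + 2)
  | q, k + 1, x => x (q + 1) && ladderAnd (q + 2) k x

theorem towerMap_towerMap (q : ℕ) (x : ℕ → Bool) : towerMap q (towerMap q x) = x := by
  simp [towerMap]

theorem ladderMap_ladderMap (q k : ℕ) (x : ℕ → Bool) : ladderMap q k (ladderMap q k x) = x := by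
  induction k generalizing q x with
  | zero => exact towerMap_towerMap q x
  | succ k ih => simp only [ladderMap, towerMap_towerMap, ih]

theorem towerMap_update {q i : ℕ} (h : i < q) (x : ℕ → Bool) (b : Bool) :
    towerMap q (Function.update x i b) = Function.update (towerMap q x) i b := by
  rw [towerMap, towerMap, Function.update_of_ne (by omega), Function.update_of_ne (by omega),
    Function.update_of_ne (by omega), Function.update_comm (by omega)]

theorem ladderMap_update {q i : ℕ} (h : i < q) (k : ℕ) (x : ℕ → Bool) (b : Bool) :
    ladderMap q k (Function.update x i b) = Function.update (ladderMap q k x) i b := by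
  induction k generalizing q x with
  | zero => exact towerMap_update h x b
  | succ k ih =>
    simp only [ladderMap]
    rw [towerMap_update h, ih (by omega), towerMap_update h]

theorem ladderAnd_update {q i : ℕ} (h : i ≤ q) (k : ℕ) (x : ℕ → Bool) (b : Bool) :
    ladderAnd q k (Function.update x i b) = ladderAnd q k x := by
  induction k generalizing q with
  | zero =>
    rw [ladderAnd, ladderAnd, Function.update_of_ne (by omega), Function.update_of_ne (by omega)]
  | succ k ih => rw [ladderAnd, ladderAnd, Function.update_of_ne (by omega), ih (by omega)]

theorem ladderMap_of_lt {q i : ℕ} (h : i < q) (k : ℕ) (x : ℕ → Bool) :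
    ladderMap q k x i = x i := by
  have := ladderMap_update h k x (x i)
  rw [Function.update_eq_self] at this
  rw [this, Function.update_self]

/-- Let A be the conjunction of the inner ladder. The two outer gates add x(q+1) x(q+2) and x(q+1)
(x(q+2) + A) to the target; the sum is x(q+1) A whatever wire `q + 2` contained, so that wire is
merely borrowed. -/
theorem ladderMap_self (q k : ℕ) (x : ℕ → Bool) :
    ladderMap q k x q = xor (x q) (ladderAnd q k x) := by
  induction k generalizing q x with
  | zero => simp [ladderMap, towerMap, ladderAnd]
  | succ k ih =>
    rw [ladderMap, towerMap, Function.update_self, ih, ladderMap_of_lt (by omega),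
      ladderMap_of_lt (by omega), towerMap, ladderAnd_update (by omega), Function.update_self,
      Function.update_of_ne (by omega), Function.update_of_ne (by omega), ladderAnd]
    cases x q <;> cases x (q + 1) <;> cases x (q + 2) <;> cases ladderAnd (q + 2) k x <;> rfl

/-- The long ladder also disturbs its inner targets. The short ladder is an involution that ignores
wire `q`, so it undoes precisely this disturbance. -/
theorem ladderMap_comp (q k : ℕ) (x : ℕ → Bool) :
    ladderMap (q + 2) k (ladderMap q (k + 1) x) =
      Function.update x q (xor (x q) (ladderAnd q (k + 1) x)) := by
  rw [← ladderMap_self, ladderMap]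
  conv_lhs => rw [towerMap]
  rw [ladderMap_update (by omega), ladderMap_ladderMap]
  simp [towerMap]

theorem ladderAnd_iff (q k : ℕ) (x : ℕ → Bool) :
    ladderAnd q k x = true ↔ (∀ j ≤ k, x (q + 2 * j + 1) = true) ∧ x (q + 2 * k + 2) = true := by
  induction k generalizing q with
  | zero => simp [ladderAnd]
  | succ k ih =>
    rw [ladderAnd, Bool.and_eq_true, ih]
    constructor
    · rintro ⟨h₀, h₁, h₂⟩
      refine ⟨fun j hj => ?_, by convert h₂ using 2; ring⟩
      rcases j with _ | j
      · exact h₀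
      · convert h₁ j (by omega) using 2; ring
    · rintro ⟨h₁, h₂⟩
      refine ⟨h₁ 0 (by omega), fun j hj => ?_, by convert h₂ using 2; ring⟩
      convert h₁ (j + 1) (by omega) using 2; ring

/-- A bit string, continued by zeros. -/
def extendBits {N : ℕ} (z : Fin N → Bool) : ℕ → Bool := fun i =>
  if h : i < N then z ⟨i, h⟩ else false

theorem extendBits_injective {N : ℕ} : Function.Injective (@extendBits N) := by
  intro x y h
  funext i
  simpa [extendBits] using congrFun h i

theorem extendBits_update {N : ℕ} (z : Fin N → Bool) (i : Fin N) (b : Bool) :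
    extendBits (Function.update z i b) = Function.update (extendBits z) i b := by
  funext j
  by_cases hj : j = i
  · subst hj; simp [extendBits]
  · rw [Function.update_of_ne hj]
    by_cases h : j < N
    · have : (⟨j, h⟩ : Fin N) ≠ i := fun h' => hj (by rw [← h'])
      simp [extendBits, h, Function.update_of_ne this]
    · simp [extendBits, h]

/-- The circuit `U` permutes the basis states as `F` prescribes. -/
def ActsAs {N : ℕ} (U : QCircuit N) (F : (ℕ → Bool) → (ℕ → Bool)) : Prop :=
  ∃ f, QCircuit.op U = basisMapOp f ∧ ∀ z, extendBits (f z) = F (extendBits z)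

theorem ActsAs.append {N : ℕ} {U V : QCircuit N} {F G : (ℕ → Bool) → (ℕ → Bool)}
    (hU : ActsAs U F) (hV : ActsAs V G) : ActsAs (U ++ V) (fun x => G (F x)) := by
  obtain ⟨f, hf, hF⟩ := hU
  obtain ⟨g, hg, hG⟩ := hV
  exact ⟨fun x => g (f x), by rw [QCircuit.op_append, hf, hg, basisMapOp_mul],
    fun z => by rw [hG, hF]⟩

theorem ActsAs.op_eq {N : ℕ} {U : QCircuit N} {F : (ℕ → Bool) → (ℕ → Bool)} (hU : ActsAs U F)
    {f : (Fin N → Bool) → (Fin N → Bool)} (h : ∀ z, F (extendBits z) = extendBits (f z)) :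
    QCircuit.op U = basisMapOp f := by
  obtain ⟨g, hg, hF⟩ := hU
  rw [hg]
  congr 1
  funext z
  exact extendBits_injective (by rw [hF, h])

theorem actsAs_towerGate {N q : ℕ} (h : q + 2 < N) : ActsAs (towerGate N q) (towerMap q) := by
  refine ⟨_, by rw [towerGate, dif_pos h, QCircuit.op_singleton]; rfl, fun z => ?_⟩
  rw [toffoliBit, extendBits_update, towerMap]
  simp [extendBits, h, show q < N by omega, show q + 1 < N by omega]

theorem ladder_zero (N q : ℕ) : ladder N q 0 = towerGate N q := by simp [ladder]

/-- The explicit list suits the emitting loops, this recursion the induction on the action. -/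
theorem ladder_succ (N q k : ℕ) :
    ladder N q (k + 1) = towerGate N q ++ (ladder N (q + 2) k ++ towerGate N q) := by
  have e : ∀ j, q + 2 * (j + 1) = q + 2 + 2 * j := fun j => by ring
  simp only [ladder, List.range_succ_eq_map, List.flatMap_cons, List.flatMap_map,
    List.reverse_cons, List.flatMap_append, ← List.map_reverse, Nat.succ_eq_add_one, e,
    List.append_assoc, mul_zero, add_zero, List.flatMap_nil, List.append_nil]

theorem actsAs_ladder {N q k : ℕ} (h : q + 2 * k + 2 < N) :
    ActsAs (ladder N q k) (ladderMap q k) := by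
  induction k generalizing q with
  | zero => rw [ladder_zero]; exact actsAs_towerGate (by omega)
  | succ k ih =>
    rw [ladder_succ]
    exact (actsAs_towerGate (by omega)).append ((ih (by omega)).append
      (actsAs_towerGate (by omega)))

/-- Whether all bits from the third one on are `1`. -/
def allOnes {w : ℕ} (z : Fin (w + 2) → Bool) : Bool :=
  decide (∀ i : Fin w, z i.succ.succ = true)

/-- Flip the bit `j` if all bits from the third one on are `1`. -/
def flipIfAllOnes {w : ℕ} (j : Fin (w + 2)) (z : Fin (w + 2) → Bool) : Fin (w + 2) → Bool :=
  Function.update z j (xor (z j) (allOnes z))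

/-- One conjunction runs over even wires, the other over odd ones, and each ends with a control of
the opposite parity. For either parity of `w` they cover exactly the wires from `2` to `w + 1`. -/
theorem ladderAnd_and_ladderAnd {w : ℕ} (hw : 4 ≤ w) (z : Fin (w + 2) → Bool) :
    (ladderAnd 1 (w / 2 - 2 + 1) (extendBits z) && ladderAnd 2 ((w + 1) / 2 - 2) (extendBits z)) =
      allOnes z := by
  rw [Bool.eq_iff_iff, Bool.and_eq_true, ladderAnd_iff, ladderAnd_iff, allOnes, decide_eq_true_iff]
  have key : (∀ i : Fin w, z i.succ.succ = true) ↔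
      ∀ i, 2 ≤ i → i < w + 2 → extendBits z i = true := by
    constructor
    · intro h i h₁ h₂
      have := h ⟨i - 2, by omega⟩
      have e : (⟨i - 2, by omega⟩ : Fin w).succ.succ = ⟨i, h₂⟩ := by
        ext; simp; omega
      rw [e] at this
      simp [extendBits, h₂, this]
    · intro h i
      have := h (i.val + 2) (by omega) (by omega)
      have e : (⟨i.val + 2, by omega⟩ : Fin (w + 2)) = i.succ.succ := by ext; simp
      simpa [extendBits, e] using this
  rw [key]
  constructor
  · rintro ⟨⟨h₁, h₂⟩, h₃, h₄⟩ i hi hi'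
    rcases Nat.even_or_odd' i with ⟨j, rfl | rfl⟩
    · by_cases hj : j - 1 ≤ w / 2 - 2 + 1
      · convert h₁ (j - 1) hj using 2; omega
      · convert h₄ using 2; omega
    · by_cases hj : j - 1 ≤ (w + 1) / 2 - 2
      · convert h₃ (j - 1) hj using 2; omega
      · convert h₂ using 2; omega
  · intro h
    exact ⟨⟨fun j hj => h _ (by omega) (by omega), h _ (by omega) (by omega)⟩,
      fun j hj => h _ (by omega) (by omega), h _ (by omega) (by omega)⟩

/-- With the two conjunctions E and O, one half adds E to qubit 1 and then x₁ O to qubit 0. Two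
halves restore qubit 1 and add (x₁ + E) O + x₁ O = E O to qubit 0. -/
theorem op_allOnesFlip {w : ℕ} (hw : 4 ≤ w) :
    QCircuit.op (allOnesFlip w) = basisMapOp (flipIfAllOnes 0) := by
  have h := (actsAs_ladder (N := w + 2) (q := 1) (k := w / 2 - 2 + 1) (by omega)).append
    ((actsAs_ladder (q := 3) (k := w / 2 - 2) (by omega)).append
    ((actsAs_ladder (q := 0) (k := (w + 1) / 2 - 2 + 1) (by omega)).append
    (actsAs_ladder (q := 2) (k := (w + 1) / 2 - 2) (by omega))))
  refine (h.append h).op_eq fun z => ?_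
  rw [flipIfAllOnes, extendBits_update, ← ladderAnd_and_ladderAnd hw]
  simp only [ladderMap_comp 1, ladderMap_comp 0]
  have e : ∀ x, ladderAnd 0 ((w + 1) / 2 - 2 + 1) x = (x 1 && ladderAnd 2 ((w + 1) / 2 - 2) x) :=
    fun x => rfl
  simp only [e]
  rw [show ((0 : Fin (w + 2)) : ℕ) = 0 from rfl]
  have e₀ : extendBits z 0 = z 0 := by simp [extendBits]
  rw [← e₀]
  generalize extendBits z = x
  have a : ∀ (i : ℕ) (_ : i ≤ 1) (y : ℕ → Bool) b, ladderAnd 1 (w / 2 - 2 + 1)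
      (Function.update y i b) = ladderAnd 1 (w / 2 - 2 + 1) y :=
    fun i hi y b => ladderAnd_update hi _ _ _
  have b : ∀ (i : ℕ) (_ : i ≤ 1) (y : ℕ → Bool) b, ladderAnd 2 ((w + 1) / 2 - 2)
      (Function.update y i b) = ladderAnd 2 ((w + 1) / 2 - 2) y :=
    fun i hi y b => ladderAnd_update (by omega) _ _ _
  simp only [a 0 (by omega), a 1 (by omega), b 0 (by omega), b 1 (by omega)]
  funext i
  by_cases h0 : i = 0
  · subst h0
    simp
    cases x 0 <;> cases x 1 <;> cases ladderAnd 1 (w / 2 - 2 + 1) x <;>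
      cases ladderAnd 2 ((w + 1) / 2 - 2) x <;> rfl
  by_cases h1 : i = 1
  · subst h1
    simp
  · simp [h0, h1]

/-! ### Tensor products of one-qubit operators -/

/-- The tensor product of one-qubit operators. -/
def tensorOp {N : ℕ} (F : Fin N → Matrix Bool Bool ℂ) : QOp N :=
  Matrix.of fun x y => ∏ i, F i (x i) (y i)

theorem tensorOp_mul {N : ℕ} (F G : Fin N → Matrix Bool Bool ℂ) :
    tensorOp F * tensorOp G = tensorOp (F * G) := by
  ext x y
  simp only [Matrix.mul_apply, tensorOp, Matrix.of_apply, Pi.mul_apply]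
  rw [Finset.prod_univ_sum, Fintype.piFinset_univ]
  exact Finset.sum_congr rfl fun z _ => Finset.prod_mul_distrib.symm

theorem tensorOp_one {N : ℕ} : tensorOp (1 : Fin N → Matrix Bool Bool ℂ) = 1 := by
  ext x y
  simp only [tensorOp, Matrix.of_apply, Pi.one_apply, Matrix.one_apply]
  by_cases h : x = y
  · simp [h]
  · rw [if_neg h]
    obtain ⟨i, hi⟩ := Function.ne_iff.mp h
    exact Finset.prod_eq_zero (Finset.mem_univ i) (if_neg hi)

theorem singleQubitOp_eq_tensorOp {N : ℕ} (M : Matrix Bool Bool ℂ) (i : Fin N) :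
    singleQubitOp M i = tensorOp (Function.update 1 i M) := by
  ext x y
  simp only [singleQubitOp, tensorOp, Matrix.of_apply]
  split_ifs with h
  · rw [Finset.prod_eq_single i]
    · simp
    · intro j _ hj
      simp [Function.update_of_ne hj, h j hj]
    · simp
  · push Not at h
    obtain ⟨j, hj, hne⟩ := h
    refine (Finset.prod_eq_zero (Finset.mem_univ j) ?_).symm
    simp [Function.update_of_ne hj, hne]

theorem op_map_singleQubit {N : ℕ} (M : Matrix Bool Bool ℂ) (G : Fin N → QGate N)
    (hG : ∀ i, (G i).op = singleQubitOp M i) (l : List (Fin N)) (hl : l.Nodup) :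
    QCircuit.op (l.map G) = tensorOp fun i => if i ∈ l then M else 1 := by
  induction l with
  | nil =>
    simp only [List.map_nil, QCircuit.op_nil, List.not_mem_nil, if_false]
    exact tensorOp_one.symm
  | cons i l ih =>
    rw [List.nodup_cons] at hl
    rw [List.map_cons, QCircuit.op_cons, ih hl.2, hG, singleQubitOp_eq_tensorOp, tensorOp_mul]
    congr 1
    funext j
    by_cases hj : j = i
    · subst hj; simp [hl.1]
    · simp [hj]

/-- The Pauli `X` matrix. -/
def flipMatrix : Matrix Bool Bool ℂ := Matrix.of fun b c => if b = c then 0 else 1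

/-- In this form the NOT gates join the Hadamard gates in a single tensor product. -/
theorem op_x {N : ℕ} (i : Fin N) : (QGate.x i).op = singleQubitOp flipMatrix i := by
  ext x y
  simp only [QGate.op, basisMapOp, singleQubitOp, flipMatrix, Matrix.of_apply]
  by_cases h : ∀ j, j ≠ i → x j = y j
  · rw [if_pos h]
    by_cases hi : x i = y i
    · rw [if_pos hi, if_neg]
      intro h'
      have := congrFun h' i
      rw [flipBit, Function.update_self, hi] at this
      revert this
      cases y i <;> decide
    · rw [if_neg hi, if_pos]
      funext j
      by_cases hj : j = i
      · subst hj
        rw [flipBit, Function.update_self]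
        revert hi
        cases x j <;> cases y j <;> simp
      · rw [flipBit, Function.update_of_ne hj, h j hj]
  · rw [if_neg h, if_neg]
    rintro h'
    exact h fun j hj => by rw [h', flipBit, Function.update_of_ne hj]

theorem hadamardMatrix_mul_self : hadamardMatrix * hadamardMatrix = 1 := by
  have h : (Real.sqrt 2 : ℂ) * (Real.sqrt 2 : ℂ) = 2 := by
    rw [← Complex.ofReal_mul, Real.mul_self_sqrt (by norm_num)]
    norm_num
  have h0 : (Real.sqrt 2 : ℂ) ≠ 0 := fun h' => by rw [h'] at h; norm_num at h
  ext b c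
  cases b <;> cases c <;>
    simp [Matrix.mul_apply, hadamardMatrix] <;> field_simp <;>
      simp [sq, h] <;> norm_num

theorem hadamardMatrix_sq (b : Bool) : hadamardMatrix true b * hadamardMatrix true b = 1 / 2 := by
  have h : (Real.sqrt 2 : ℂ) * (Real.sqrt 2 : ℂ) = 2 := by
    rw [← Complex.ofReal_mul, Real.mul_self_sqrt (by norm_num)]
    norm_num
  rw [hadamardMatrix, Matrix.of_apply, div_mul_div_comm, h]
  cases b <;> simp

theorem hadamardMatrix_symm (b c : Bool) : hadamardMatrix b c = hadamardMatrix c b := by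
  cases b <;> cases c <;> rfl

theorem flipMatrix_mul_self : flipMatrix * flipMatrix = 1 := by
  ext b c
  cases b <;> cases c <;> simp [Matrix.mul_apply, flipMatrix]

theorem flipMatrix_symm (b c : Bool) : flipMatrix b c = flipMatrix c b := by
  cases b <;> cases c <;> rfl

theorem hadamard_flip_hadamard :
    hadamardMatrix * flipMatrix * hadamardMatrix =
      Matrix.diagonal fun b => if b then -1 else 1 := by
  have h : (Real.sqrt 2 : ℂ) * (Real.sqrt 2 : ℂ) = 2 := by
    rw [← Complex.ofReal_mul, Real.mul_self_sqrt (by norm_num)]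
    norm_num
  have h0 : (Real.sqrt 2 : ℂ) ≠ 0 := fun h' => by rw [h'] at h; norm_num at h
  ext b c
  cases b <;> cases c <;>
    simp [Matrix.mul_apply, hadamardMatrix, flipMatrix] <;> field_simp <;>
      simp [sq, h] <;> norm_num

/-! ### The layer of Hadamard and NOT gates -/

/-- The one-qubit operators of `inputLayer`. -/
noncomputable def layerFactor (n ξ : ℕ) (i : Fin (n + ξ + 2)) : Matrix Bool Bool ℂ :=
  (if i ∈ ((List.finRange n).map fun i => (i.castAdd ξ).succ.succ).reverse then hadamardMatrix
    else 1) *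
  (if i ∈ ((List.finRange ξ).map fun i => (i.natAdd n).succ.succ).reverse then flipMatrix else 1)

theorem op_inputLayer (n ξ : ℕ) : QCircuit.op (inputLayer n ξ) = tensorOp (layerFactor n ξ) := by
  have h₁ := op_map_singleQubit hadamardMatrix QGate.h (fun _ => rfl)
    ((List.finRange n).map fun i => (i.castAdd ξ).succ.succ).reverse
    (List.nodup_reverse.mpr ((List.nodup_finRange n).map
      (f := fun i : Fin n => (i.castAdd ξ).succ.succ) (fun i j h => by simpa using h)))
  have h₂ := op_map_singleQubit flipMatrix QGate.x op_x
    ((List.finRange ξ).map fun i => (i.natAdd n).succ.succ).reverse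
    (List.nodup_reverse.mpr ((List.nodup_finRange ξ).map
      (f := fun i : Fin ξ => (i.natAdd n).succ.succ) (fun i j h => by simpa using h)))
  rw [List.map_reverse, List.map_map] at h₁ h₂
  have : inputLayer n ξ = _ ++ _ := rfl
  rw [this, QCircuit.op_append]
  erw [h₁, h₂]
  rw [tensorOp_mul]
  rfl

theorem layerFactor_zero (n ξ : ℕ) : layerFactor n ξ 0 = 1 := by
  simp [layerFactor, Fin.succ_ne_zero]

theorem layerFactor_one (n ξ : ℕ) : layerFactor n ξ 1 = 1 := by
  have h : ∀ i : Fin (n + ξ), i.succ.succ ≠ 1 := fun i h => by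
    have := congrArg Fin.val h
    simp at this
  simp [layerFactor, h]

theorem layerFactor_input {n ξ : ℕ} (i : Fin n) :
    layerFactor n ξ (i.castAdd ξ).succ.succ = hadamardMatrix := by
  have h : ∀ j : Fin ξ, j.natAdd n ≠ i.castAdd ξ := fun j h => by
    have := congrArg Fin.val h
    simp at this
    omega
  simp [layerFactor, h]

theorem layerFactor_ancilla {n ξ : ℕ} (i : Fin ξ) :
    layerFactor n ξ (i.natAdd n).succ.succ = flipMatrix := by
  have h : ∀ j : Fin n, j.castAdd ξ ≠ i.natAdd n := fun j h => by
    have := congrArg Fin.val h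
    simp at this
    omega
  simp [layerFactor, h]

theorem layerFactor_cases {n ξ : ℕ} {p : Matrix Bool Bool ℂ → Prop} (h₁ : p 1)
    (h₂ : p hadamardMatrix) (h₃ : p flipMatrix) (i : Fin (n + ξ + 2)) :
    p (layerFactor n ξ i) := by
  induction i using Fin.cases with
  | zero => rwa [layerFactor_zero]
  | succ i =>
    induction i using Fin.cases with
    | zero => rw [Fin.succ_zero_eq_one, layerFactor_one]; exact h₁
    | succ i =>
      induction i using Fin.addCases with
      | left i => rwa [layerFactor_input]
      | right i => rwa [layerFactor_ancilla]

theorem layer_mul_self (n ξ : ℕ) :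
    tensorOp (layerFactor n ξ) * tensorOp (layerFactor n ξ) = 1 := by
  rw [tensorOp_mul, ← tensorOp_one]
  congr 1
  funext i
  exact layerFactor_cases (p := fun M => M * M = 1) (one_mul 1) hadamardMatrix_mul_self
    flipMatrix_mul_self i

theorem layer_symm {n ξ : ℕ} (x y : Fin (n + ξ + 2) → Bool) :
    tensorOp (layerFactor n ξ) x y = tensorOp (layerFactor n ξ) y x := by
  simp only [tensorOp, Matrix.of_apply]
  refine Finset.prod_congr rfl fun i _ => ?_
  exact layerFactor_cases (p := fun M => ∀ b c, M b c = M c b)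
    (fun b c => by simp [Matrix.one_apply, eq_comm]) hadamardMatrix_symm flipMatrix_symm i _ _

theorem layer_eq_zero {n ξ : ℕ} {x y : Fin (n + ξ + 2) → Bool} {i : Fin (n + ξ + 2)}
    (hi : layerFactor n ξ i = 1) (h : x i ≠ y i) : tensorOp (layerFactor n ξ) x y = 0 := by
  refine Finset.prod_eq_zero (Finset.mem_univ i) ?_
  rw [hi, Matrix.one_apply_ne h]

/-! ### The reversible circuit on the data qubits -/

/-- The string with first bits `c` and `b`, followed by `x`. -/
def joinBits {w : ℕ} (c b : Bool) (x : Fin w → Bool) : Fin (w + 2) → Bool :=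
  Matrix.vecCons c (Matrix.vecCons b x)

/-- The bits from the third one on. -/
def dataBits {w : ℕ} (z : Fin (w + 2) → Bool) : Fin w → Bool := fun i => z i.succ.succ

theorem joinBits_dataBits {w : ℕ} (z : Fin (w + 2) → Bool) :
    joinBits (z 0) (z 1) (dataBits z) = z := by
  funext i
  induction i using Fin.cases with
  | zero => rfl
  | succ i =>
    induction i using Fin.cases with
    | zero => rfl
    | succ i => rfl

theorem ext_dataBits {w : ℕ} {z z' : Fin (w + 2) → Bool} (h₀ : z 0 = z' 0) (h₁ : z 1 = z' 1)
    (h : dataBits z = dataBits z') : z = z' := by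
  rw [← joinBits_dataBits z, ← joinBits_dataBits z', h₀, h₁, h]

theorem joinBits_zero {w : ℕ} (c b : Bool) (x : Fin w → Bool) : joinBits c b x 0 = c := rfl

theorem joinBits_one {w : ℕ} (c b : Bool) (x : Fin w → Bool) : joinBits c b x 1 = b := rfl

theorem dataBits_joinBits {w : ℕ} (c b : Bool) (x : Fin w → Bool) :
    dataBits (joinBits c b x) = x := rfl

theorem dataBits_update {w : ℕ} (z : Fin (w + 2) → Bool) (i : Fin w) (b : Bool) :
    dataBits (Function.update z i.succ.succ b) = Function.update (dataBits z) i b := by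
  funext j
  by_cases hj : j = i
  · subst hj; simp [dataBits]
  · have : j.succ.succ ≠ i.succ.succ := fun h => hj (by simpa using h)
    simp [dataBits, this, hj]

theorem dataBits_update_zero {w : ℕ} (z : Fin (w + 2) → Bool) (b : Bool) :
    dataBits (Function.update z 0 b) = dataBits z := by
  funext j
  simp [dataBits, Fin.succ_ne_zero]

theorem dataBits_update_one {w : ℕ} (z : Fin (w + 2) → Bool) (b : Bool) :
    dataBits (Function.update z 1 b) = dataBits z := by
  funext j
  have : j.succ.succ ≠ (1 : Fin (w + 2)) := fun h => by
    have := congrArg Fin.val h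
    simp at this
  simp [dataBits, this]

/-- The action of a map on the bits from the third one on. -/
def onData {w : ℕ} (f : (Fin w → Bool) → (Fin w → Bool)) (z : Fin (w + 2) → Bool) :
    Fin (w + 2) → Bool := joinBits (z 0) (z 1) (f (dataBits z))

theorem op_lift {w : ℕ} (g : RevGate w) : g.lift.op = basisMapOp (onData g.apply) := by
  have h1 : ∀ i : Fin w, (1 : Fin (w + 2)) ≠ i.succ.succ := fun i h => by
    have := congrArg Fin.val h
    simp at this
  have h0 : ∀ i : Fin w, (0 : Fin (w + 2)) ≠ i.succ.succ := fun i => (Fin.succ_ne_zero _).symm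
  cases g with
  | not i =>
    simp only [RevGate.lift, QGate.op]
    congr 1
    funext z
    refine ext_dataBits ?_ ?_ ?_
    · simp [flipBit, h0, onData, joinBits_zero]
    · simp [flipBit, h1, onData, joinBits_one]
    · rw [flipBit, dataBits_update]; rfl
  | toffoli i j k _ _ _ =>
    simp only [RevGate.lift, QGate.op]
    congr 1
    funext z
    refine ext_dataBits ?_ ?_ ?_
    · simp [toffoliBit, h0, onData, joinBits_zero]
    · simp [toffoliBit, h1, onData, joinBits_one]
    · rw [toffoliBit, dataBits_update]; rfl

theorem RevCircuit.apply_append {w : ℕ} (C D : RevCircuit w) (x : Fin w → Bool) :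
    RevCircuit.apply (C ++ D) x = RevCircuit.apply D (RevCircuit.apply C x) := by
  simp [RevCircuit.apply]

theorem RevGate.apply_apply {w : ℕ} (g : RevGate w) (x : Fin w → Bool) :
    g.apply (g.apply x) = x := by
  cases g with
  | not i => simp [RevGate.apply, flipBit]
  | toffoli i j k hij hik hjk => simp [RevGate.apply, toffoliBit, hik, hjk]

theorem RevCircuit.apply_reverse {w : ℕ} (C : RevCircuit w) (x : Fin w → Bool) :
    RevCircuit.apply C.reverse (RevCircuit.apply C x) = x := by
  induction C generalizing x with
  | nil => rfl
  | cons g C ih =>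
    rw [List.reverse_cons, RevCircuit.apply_append]
    change g.apply (RevCircuit.apply C.reverse (RevCircuit.apply C (g.apply x))) = x
    rw [ih, g.apply_apply]

theorem op_map_lift {w : ℕ} (C : RevCircuit w) :
    QCircuit.op (C.map RevGate.lift) = basisMapOp (onData (RevCircuit.apply C)) := by
  induction C with
  | nil =>
    rw [List.map_nil, QCircuit.op_nil, ← basisMapOp_id]
    congr 1
    funext z
    exact (joinBits_dataBits z).symm
  | cons g C ih =>
    rw [List.map_cons, QCircuit.op_cons, ih, op_lift, basisMapOp_mul]
    rfl

theorem singleQubitOp_mul_apply {N : ℕ} (M : Matrix Bool Bool ℂ) (i : Fin N) (A : QOp N)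
    (x y : Fin N → Bool) :
    (singleQubitOp M i * A) x y = ∑ b, M (x i) b * A (Function.update x i b) y := by
  rw [Matrix.mul_apply]
  refine (Fintype.sum_of_injective (fun b => Function.update x i b)
    (Function.update_injective x i) _ _ (fun z hz => ?_) fun b => ?_).symm
  · rw [singleQubitOp, Matrix.of_apply, if_neg, zero_mul]
    intro h
    refine hz ⟨z i, funext fun j => ?_⟩
    by_cases hj : j = i
    · subst hj; simp
    · simp [hj, h j hj]
  · rw [singleQubitOp, Matrix.of_apply, if_pos fun j hj => by rw [Function.update_of_ne hj],
      Function.update_self]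

/-- Hadamard gates on the target turn a controlled NOT into a controlled phase. -/
theorem op_lastPhase {w : ℕ} (hw : 0 < w) :
    QCircuit.op (lastPhase w hw) =
      Matrix.diagonal fun z => if z 1 && z (Fin.last (w + 1)) then -1 else 1 := by
  have h1 : Fin.last (w + 1) ≠ 1 := by simp [Fin.ext_iff]; omega
  rw [lastPhase, QCircuit.op_cons, QCircuit.op_cons, QCircuit.op_singleton]
  simp only [QGate.op]
  rw [mul_assoc]
  ext x y
  rw [singleQubitOp_mul_apply]
  have hM : ∀ z, (basisMapOp (fun y : Fin (w + 2) → Bool =>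
      Function.update y 1 (xor (y 1) (y (Fin.last (w + 1))))) * singleQubitOp hadamardMatrix 1 : QOp (w + 2)) z y
      = singleQubitOp hadamardMatrix 1 (Function.update z 1
        (xor (z 1) (z (Fin.last (w + 1))))) y := by
    refine fun z => basisMapOp_mul_apply _ (fun z => ?_) z y
    simp [h1]
  simp only [hM, Function.update_self, Function.update_of_ne h1, Function.update_idem]
  have key : ∀ b, singleQubitOp hadamardMatrix 1 (Function.update x 1 b) y =
      if ∀ j, j ≠ 1 → x j = y j then hadamardMatrix b (y 1) else 0 := by
    intro b
    rw [singleQubitOp, Matrix.of_apply, Function.update_self]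
    congr 1
    exact propext (forall_congr' fun j => imp_congr_right fun hj => by
      rw [Function.update_of_ne hj])
  simp only [key]
  by_cases h : ∀ j, j ≠ 1 → x j = y j
  · simp only [if_pos h]
    have e₁ : ∑ b, hadamardMatrix (x 1) b * hadamardMatrix b (y 1) =
        if x 1 = y 1 then 1 else 0 := by
      rw [← Matrix.mul_apply, hadamardMatrix_mul_self, Matrix.one_apply]
    have e₂ : ∑ b, hadamardMatrix (x 1) b * hadamardMatrix (!b) (y 1) =
        if x 1 = y 1 then (if x 1 then -1 else 1) else 0 := by
      have := congrFun (congrFun hadamard_flip_hadamard (x 1)) (y 1)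
      rw [Matrix.diagonal_apply] at this
      rw [← this, mul_assoc, Matrix.mul_apply]
      refine Finset.sum_congr rfl fun b _ => ?_
      congr 1
      rw [Matrix.mul_apply]
      cases b <;> simp [flipMatrix]
    have hxy : x = y ↔ x 1 = y 1 :=
      ⟨fun h => by rw [h], fun h' => funext fun j => by
        by_cases hj : j = 1
        · rw [hj, h']
        · exact h j hj⟩
    simp only [Matrix.diagonal_apply, hxy]
    -- With control 0 the Hadamard gates cancel; with control 1 they conjugate X to Z.
    cases hl : x (Fin.last (w + 1))
    · simpa using e₁
    · simpa using e₂
  · rw [Matrix.diagonal_apply_ne _ fun hxy => h fun j _ => by rw [hxy]]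
    simp [h]

/-! ### The operator of the phase block -/

/-- The phase that `phaseBlock` applies between its two layers. -/
def phaseSign {w : ℕ} (C : RevCircuit w) (z : Fin (w + 2) → Bool) : ℂ :=
  if z 1 && lastBit (RevCircuit.apply C (dataBits z)) then -1 else 1

theorem phaseSign_mul_self {w : ℕ} (C : RevCircuit w) (z : Fin (w + 2) → Bool) :
    phaseSign C z * phaseSign C z = 1 := by
  unfold phaseSign
  split_ifs <;> simp

theorem lastBit_dataBits {w : ℕ} (hw : 0 < w) (z : Fin (w + 2) → Bool) :
    lastBit (dataBits z) = z (Fin.last (w + 1)) := by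
  rw [lastBit, dif_pos hw, dataBits]
  congr 1
  ext
  simp
  omega

/-- `C` permutes the basis states and its reversal undoes it, so the conjugated operator stays
diagonal and the phase is pulled back along `C`. -/
theorem op_conjugated_lastPhase {w : ℕ} (hw : 0 < w) (C : RevCircuit w) :
    QCircuit.op (C.reverse.map RevGate.lift) * QCircuit.op (lastPhase w hw) *
      QCircuit.op (C.map RevGate.lift) = Matrix.diagonal (phaseSign C) := by
  rw [op_map_lift, op_map_lift, op_lastPhase]
  ext x y
  rw [mul_basisMapOp_apply, Matrix.mul_diagonal]
  have h : onData (RevCircuit.apply C.reverse) (onData (RevCircuit.apply C) y) = y := by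
    rw [onData, onData, dataBits_joinBits, RevCircuit.apply_reverse, joinBits_zero, joinBits_one,
      joinBits_dataBits]
  rw [basisMapOp, Matrix.of_apply, h, Matrix.diagonal_apply,
    ← lastBit_dataBits hw (onData (RevCircuit.apply C) y)]
  by_cases hxy : x = y
  · rw [if_pos hxy, if_pos hxy, one_mul, hxy]
    rfl
  · rw [if_neg hxy, if_neg hxy, zero_mul]

section phaseBlock

variable {n ξ : ℕ} (hw : 0 < n + ξ) (C : RevCircuit (n + ξ))

theorem op_phaseBlock :
    QCircuit.op (phaseBlock hw C) =
      tensorOp (layerFactor n ξ) * Matrix.diagonal (phaseSign C) * tensorOp (layerFactor n ξ) := by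
  rw [← op_conjugated_lastPhase hw, phaseBlock]
  simp only [QCircuit.op_append, op_inputLayer, mul_assoc]

theorem op_phaseBlock_apply (x y : Fin (n + ξ + 2) → Bool) :
    QCircuit.op (phaseBlock hw C) x y = ∑ z, tensorOp (layerFactor n ξ) x z * phaseSign C z *
      tensorOp (layerFactor n ξ) z y := by
  rw [op_phaseBlock, Matrix.mul_apply]
  simp only [Matrix.mul_diagonal]

theorem op_phaseBlock_mul_self :
    QCircuit.op (phaseBlock hw C) * QCircuit.op (phaseBlock hw C) = 1 := by
  have hD : Matrix.diagonal (phaseSign C) * Matrix.diagonal (phaseSign C) = 1 := by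
    rw [Matrix.diagonal_mul_diagonal]
    simp only [phaseSign_mul_self]
    exact Matrix.diagonal_one
  rw [op_phaseBlock]
  calc _ = tensorOp (layerFactor n ξ) * (Matrix.diagonal (phaseSign C) *
        (tensorOp (layerFactor n ξ) * tensorOp (layerFactor n ξ)) *
        Matrix.diagonal (phaseSign C)) * tensorOp (layerFactor n ξ) := by
        simp only [mul_assoc]
    _ = 1 := by rw [layer_mul_self, mul_one, hD, mul_one, layer_mul_self]

theorem op_phaseBlock_symm (x y : Fin (n + ξ + 2) → Bool) :
    QCircuit.op (phaseBlock hw C) x y = QCircuit.op (phaseBlock hw C) y x := by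
  rw [op_phaseBlock_apply, op_phaseBlock_apply]
  refine Finset.sum_congr rfl fun z _ => ?_
  rw [layer_symm x z, layer_symm z y]
  ring

theorem op_phaseBlock_eq_zero {x y : Fin (n + ξ + 2) → Bool} (h : x 0 ≠ y 0 ∨ x 1 ≠ y 1) :
    QCircuit.op (phaseBlock hw C) x y = 0 := by
  rw [op_phaseBlock_apply]
  refine Finset.sum_eq_zero fun z _ => ?_
  have key : ∀ i, layerFactor n ξ i = 1 → x i ≠ y i →
      tensorOp (layerFactor n ξ) x z * phaseSign C z * tensorOp (layerFactor n ξ) z y = 0 := by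
    intro i hi hxy
    by_cases hz : x i = z i
    · rw [layer_eq_zero (x := z) (y := y) hi (hz ▸ hxy), mul_zero]
    · rw [layer_eq_zero hi hz, zero_mul, zero_mul]
  rcases h with h | h
  · exact key 0 (layerFactor_zero n ξ) h
  · exact key 1 (layerFactor_one n ξ) h

/-- With qubit 1 off there is no phase, and the two layers cancel. -/
theorem op_phaseBlock_of_off {u : Fin (n + ξ + 2) → Bool} (hu : u 1 = false)
    (x : Fin (n + ξ + 2) → Bool) :
    QCircuit.op (phaseBlock hw C) x u = if x = u then 1 else 0 := by
  rw [← Matrix.one_apply, ← layer_mul_self n ξ, op_phaseBlock_apply, Matrix.mul_apply]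
  refine Finset.sum_congr rfl fun z _ => ?_
  by_cases hz : z 1 = u 1
  · rw [phaseSign, hz, hu, Bool.false_and, if_neg (by simp), mul_one]
  · rw [layer_eq_zero (layerFactor_one n ξ) hz, mul_zero, mul_zero]

theorem layer_ones (c : Bool) (x : Fin n → Bool) :
    tensorOp (layerFactor n ξ) (joinBits c true fun _ => true)
      (joinBits c true (Fin.append x fun _ => false)) = ∏ i, hadamardMatrix true (x i) := by
  rw [tensorOp, Matrix.of_apply, Fin.prod_univ_succ, Fin.prod_univ_succ, Fin.prod_univ_add,
    layerFactor_zero, Fin.succ_zero_eq_one, layerFactor_one]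
  simp only [layerFactor_input, layerFactor_ancilla]
  rw [joinBits_zero, joinBits_zero, joinBits_one, joinBits_one]
  simp [joinBits, flipMatrix]

/-- From all-ones data the NOT gates reset the ancilla bits and the Hadamard gates reach every
input. An input enters with the square of a Hadamard amplitude, always `2^(-n)`, so only the phases
remain, and their sum is the gap. -/
theorem op_phaseBlock_ones (c : Bool) :
    QCircuit.op (phaseBlock hw C) (joinBits c true fun _ => true) (joinBits c true fun _ => true) =
      (revGap C : ℂ) / 2 ^ n := by
  rw [op_phaseBlock_apply]
  have hinj : Function.Injective fun x : Fin n → Bool =>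
      (joinBits c true (Fin.append x fun _ : Fin ξ => false) : Fin (n + ξ + 2) → Bool) := by
    intro x y h
    have := congrArg dataBits h
    simp only [dataBits_joinBits] at this
    funext i
    simpa using congrFun this (i.castAdd ξ)
  rw [← Fintype.sum_of_injective _ hinj (fun x => (1 / 2 : ℂ) ^ n *
      (-1) ^ (lastBit (RevCircuit.apply C (Fin.append x (fun _ : Fin ξ => false)))).toNat) _ ?_ ?_]
  · rw [← Finset.mul_sum, revGap, one_div, inv_pow, div_eq_inv_mul]
    push_cast
    rfl
  -- Any other string has a wrong leading bit or a nonzero ancilla bit, and its layer entry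
  -- vanishes.
  · intro z hz
    have h0 : tensorOp (layerFactor n ξ) (joinBits c true fun _ => true) z = 0 := by
      by_cases hc : c = z 0
      · by_cases hb : true = z 1
        · by_cases ha : ∀ i : Fin ξ, z (i.natAdd n).succ.succ = false
          · refine absurd ⟨fun i => z (i.castAdd ξ).succ.succ, ?_⟩ hz
            refine ext_dataBits hc hb ?_
            rw [dataBits_joinBits]
            funext i
            induction i using Fin.addCases with
            | left i => simp [dataBits]
            | right i => simp [dataBits, ha]
          · push Not at ha
            obtain ⟨i, hi⟩ := ha
            refine Finset.prod_eq_zero (Finset.mem_univ (i.natAdd n).succ.succ) ?_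
            rw [layerFactor_ancilla]
            have : z (i.natAdd n).succ.succ = true := by simpa using hi
            rw [this]
            rfl
        · exact layer_eq_zero (layerFactor_one n ξ) hb
      · exact layer_eq_zero (layerFactor_zero n ξ) hc
    rw [h0, zero_mul, zero_mul]
  · intro x
    rw [layer_symm (joinBits c true (Fin.append x _)), layer_ones, mul_right_comm,
      ← Finset.prod_mul_distrib]
    simp only [hadamardMatrix_sq, Finset.prod_const, Finset.card_univ, Fintype.card_fin]
    rw [phaseSign, joinBits_one, dataBits_joinBits, Bool.true_and]
    cases lastBit (RevCircuit.apply C (Fin.append x fun _ => false)) <;> simp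

end phaseBlock

/-! ### The acceptance probability -/

theorem dqc1AcceptProb_eq {N : ℕ} [NeZero N] (U : QOp N) :
    dqc1AcceptProb U = ((2 : ℝ) ^ (N - 1))⁻¹ *
      ∑ x, ∑ y, if x 0 = false ∧ y 0 = false then Complex.normSq (U x y) else 0 := by
  have h : Matrix.trace (firstZeroProj N * (U * dqc1Initial N * U.conjTranspose)) =
      (((2 : ℝ) ^ (N - 1))⁻¹ *
      ∑ x, ∑ y, if x 0 = false ∧ y 0 = false then Complex.normSq (U x y) else 0 : ℝ) := by
    rw [Matrix.trace, dqc1Initial, firstZeroProj, Matrix.mul_smul, Matrix.smul_mul]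
    simp only [Matrix.diag_apply, Matrix.diagonal_mul, Matrix.smul_apply]
    simp only [Matrix.mul_apply (M := U * _), Matrix.mul_diagonal, Matrix.conjTranspose_apply]
    push_cast
    rw [Finset.mul_sum]
    refine Finset.sum_congr rfl fun x _ => ?_
    rw [smul_eq_mul, mul_left_comm, Finset.mul_sum]
    congr 1
    refine Finset.sum_congr rfl fun y _ => ?_
    by_cases hx : x 0 = false <;> by_cases hy : y 0 = false <;>
      simp [hx, hy, Complex.mul_conj]
  rw [dqc1AcceptProb, h, Complex.ofReal_re]

theorem dqc1AcceptProb_nonneg {N : ℕ} [NeZero N] (U : QOp N) : 0 ≤ dqc1AcceptProb U := by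
  rw [dqc1AcceptProb_eq]
  refine mul_nonneg (by positivity) (Finset.sum_nonneg fun x _ => Finset.sum_nonneg fun y _ => ?_)
  split_ifs
  · exact Complex.normSq_nonneg _
  · exact le_rfl

theorem dqc1AcceptProb_eq_zero_iff {N : ℕ} [NeZero N] (U : QOp N) :
    dqc1AcceptProb U = 0 ↔ ∀ x y, x 0 = false → y 0 = false → U x y = 0 := by
  have hnn : ∀ x y : Fin N → Bool,
      0 ≤ if x 0 = false ∧ y 0 = false then Complex.normSq (U x y) else 0 := by
    intro x y
    split_ifs
    · exact Complex.normSq_nonneg _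
    · exact le_rfl
  rw [dqc1AcceptProb_eq, mul_eq_zero_iff_left (by positivity),
    Finset.sum_eq_zero_iff_of_nonneg fun x _ => Finset.sum_nonneg fun y _ => hnn x y]
  refine forall_congr' fun x => ?_
  simp only [Finset.mem_univ, true_imp_iff]
  rw [Finset.sum_eq_zero_iff_of_nonneg fun y _ => hnn x y]
  refine ⟨fun h y hx hy => ?_, fun h y _ => ?_⟩
  · have := h y (Finset.mem_univ y)
    rw [if_pos ⟨hx, hy⟩] at this
    exact Complex.normSq_eq_zero.mp this
  · split_ifs with hxy
    · rw [h y hxy.1 hxy.2, map_zero]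
    · rfl

theorem op_swapFirst (w : ℕ) :
    QCircuit.op (swapFirst w) = basisMapOp fun z => joinBits (z 1) (z 0) (dataBits z) := by
  have h01 : (0 : Fin (w + 2)) ≠ 1 := by simp
  have h10 : (1 : Fin (w + 2)) ≠ 0 := by simp
  rw [swapFirst, QCircuit.op_cons, QCircuit.op_cons, QCircuit.op_singleton]
  simp only [QGate.op, basisMapOp_mul]
  congr 1
  funext z
  refine ext_dataBits ?_ ?_ ?_
  · simp only [joinBits_zero, ne_eq, h01, h10, not_false_eq_true, Function.update_of_ne,
      Function.update_self]
    cases z 0 <;> cases z 1 <;> rfl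
  · simp only [joinBits_one, ne_eq, h01, h10, not_false_eq_true, Function.update_of_ne,
      Function.update_self]
    cases z 0 <;> cases z 1 <;> rfl
  · simp only [dataBits_update_zero, dataBits_update_one, dataBits_joinBits]

theorem allOnes_congr {w : ℕ} {z z' : Fin (w + 2) → Bool} (h : dataBits z = dataBits z') :
    allOnes z = allOnes z' := by
  have : ∀ i : Fin w, z i.succ.succ = z' i.succ.succ := fun i => congrFun h i
  simp only [allOnes, this]

theorem allOnes_eq_true_iff {w : ℕ} {z : Fin (w + 2) → Bool} :
    allOnes z = true ↔ dataBits z = fun _ => true := by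
  rw [allOnes, decide_eq_true_iff, funext_iff]
  rfl

/-- The swap exchanges the roles of target and borrowed qubit. -/
theorem op_swapped_allOnesFlip {w : ℕ} (hw : 4 ≤ w) :
    QCircuit.op (swapFirst w) * QCircuit.op (allOnesFlip w) * QCircuit.op (swapFirst w) =
      basisMapOp (flipIfAllOnes 1) := by
  rw [op_swapFirst, op_allOnesFlip hw, basisMapOp_mul, basisMapOp_mul]
  congr 1
  funext z
  refine ext_dataBits ?_ ?_ ?_
  · simp [flipIfAllOnes, joinBits_zero, joinBits_one]
  · rw [joinBits_one, flipIfAllOnes, flipIfAllOnes, Function.update_self, Function.update_self,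
      joinBits_zero]
    congr 1
  · rw [dataBits_joinBits, flipIfAllOnes, dataBits_update_zero, dataBits_joinBits, flipIfAllOnes,
      dataBits_update_one]

/-- The action of `offFlip`. -/
def offFlipMap {w : ℕ} (hw : 0 < w) (z : Fin (w + 2) → Bool) : Fin (w + 2) → Bool :=
  Function.update z (⟨0, hw⟩ : Fin w).succ.succ (!(xor (z (⟨0, hw⟩ : Fin w).succ.succ) (z 1)))

theorem op_offFlip {w : ℕ} (hw : 0 < w) :
    QCircuit.op (offFlip w hw) = basisMapOp (offFlipMap hw) := by
  rw [offFlip, QCircuit.op_cons, QCircuit.op_singleton]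
  simp only [QGate.op, basisMapOp_mul]
  congr 1
  funext z
  have : (⟨2, by omega⟩ : Fin (w + 2)) = (⟨0, hw⟩ : Fin w).succ.succ := rfl
  rw [this, flipBit, Function.update_self, Function.update_idem, offFlipMap]

theorem one_ne_succ_succ {w : ℕ} (i : Fin w) : (1 : Fin (w + 2)) ≠ i.succ.succ := fun h => by
  have := congrArg Fin.val h
  simp at this

theorem zero_ne_succ_succ {w : ℕ} (i : Fin w) : (0 : Fin (w + 2)) ≠ i.succ.succ :=
  (Fin.succ_ne_zero _).symm

theorem offFlipMap_zero {w : ℕ} (hw : 0 < w) (z : Fin (w + 2) → Bool) :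
    offFlipMap hw z 0 = z 0 := Function.update_of_ne (zero_ne_succ_succ _) _ _

theorem offFlipMap_one {w : ℕ} (hw : 0 < w) (z : Fin (w + 2) → Bool) :
    offFlipMap hw z 1 = z 1 := Function.update_of_ne (one_ne_succ_succ _) _ _

theorem offFlipMap_of_on {w : ℕ} (hw : 0 < w) {z : Fin (w + 2) → Bool} (hz : z 1 = true) :
    offFlipMap hw z = z := by
  rw [offFlipMap, hz, Bool.xor_true, Bool.not_not, Function.update_eq_self]

theorem offFlipMap_involutive {w : ℕ} (hw : 0 < w) :
    Function.Involutive (offFlipMap hw) := by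
  intro z
  rw [offFlipMap, offFlipMap_one]
  conv_lhs => enter [1]; rw [offFlipMap]
  rw [Function.update_idem, offFlipMap, Function.update_self]
  have : (!(xor (!(xor (z (⟨0, hw⟩ : Fin w).succ.succ) (z 1))) (z 1))) =
      z (⟨0, hw⟩ : Fin w).succ.succ := by
    cases z (⟨0, hw⟩ : Fin w).succ.succ <;> cases z 1 <;> rfl
  rw [this, Function.update_eq_self]

theorem allOnes_flipIfAllOnes_zero {w : ℕ} (z : Fin (w + 2) → Bool) :
    allOnes (flipIfAllOnes 0 z) = allOnes z :=
  allOnes_congr (dataBits_update_zero _ _)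

theorem allOnes_flipIfAllOnes_one {w : ℕ} (z : Fin (w + 2) → Bool) :
    allOnes (flipIfAllOnes 1 z) = allOnes z :=
  allOnes_congr (dataBits_update_one _ _)

theorem flipIfAllOnes_zero_involutive {w : ℕ} :
    Function.Involutive (flipIfAllOnes (w := w) 0) := by
  intro z
  rw [flipIfAllOnes, allOnes_flipIfAllOnes_zero]
  simp [flipIfAllOnes]

theorem flipBit_involutive {N : ℕ} (i : Fin N) : Function.Involutive (flipBit i) := by
  intro z
  simp [flipBit]

/-! ### When the acceptance amplitudes vanish -/

section gapCircuit

variable {n ξ : ℕ}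

/-- The outer blocks are involutive permutations of the basis, so they only relabel the row and the
column of B F B. -/
theorem op_gapCircuit_apply (hw : 4 ≤ n + ξ) (h : 0 < n + ξ) (C : RevCircuit (n + ξ))
    (x y : Fin (n + ξ + 2) → Bool) :
    QCircuit.op (gapCircuit h C) x y =
      ∑ u, QCircuit.op (phaseBlock h C) (offFlipMap h (flipIfAllOnes 0 (flipBit 0 x)))
          (flipIfAllOnes 1 u) *
        QCircuit.op (phaseBlock h C) u (offFlipMap h (flipIfAllOnes 0 y)) := by
  have e : QCircuit.op (gapCircuit h C) = basisMapOp (flipBit 0) * (basisMapOp (flipIfAllOnes 0) *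
      (basisMapOp (offFlipMap h) * ((QCircuit.op (phaseBlock h C) * basisMapOp (flipIfAllOnes 1) *
        QCircuit.op (phaseBlock h C)) * basisMapOp (offFlipMap h) *
        basisMapOp (flipIfAllOnes 0)))) := by
    rw [← op_swapped_allOnesFlip hw, ← op_offFlip, ← op_allOnesFlip hw, gapCircuit]
    simp only [QCircuit.op_append, QCircuit.op_singleton, mul_assoc]
    rfl
  rw [e, basisMapOp_mul_apply _ (flipBit_involutive 0),
    basisMapOp_mul_apply _ flipIfAllOnes_zero_involutive,
    basisMapOp_mul_apply _ (offFlipMap_involutive h), mul_basisMapOp_apply, mul_basisMapOp_apply,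
    Matrix.mul_apply]
  simp only [mul_basisMapOp_apply]

/-- If qubit 1 is off, the block is the identity and `offFlipMap` has taken `z` away from all-ones
data. If it is on, `offFlipMap` does nothing and the entry is a multiple of the gap. -/
theorem op_phaseBlock_of_gap_eq_zero (h : 0 < n + ξ) {C : RevCircuit (n + ξ)} (hC : revGap C = 0)
    {z u : Fin (n + ξ + 2) → Bool} (hz : allOnes z = true) (hu : allOnes u = true) :
    QCircuit.op (phaseBlock h C) (offFlipMap h z) u = 0 := by
  by_cases h₀ : z 0 = u 0
  swap
  · exact op_phaseBlock_eq_zero h C (Or.inl (by rwa [offFlipMap_zero]))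
  by_cases h₁ : z 1 = u 1
  swap
  · exact op_phaseBlock_eq_zero h C (Or.inr (by rwa [offFlipMap_one]))
  rw [allOnes_eq_true_iff] at hz hu
  cases hu1 : u 1
  · rw [op_phaseBlock_of_off h C hu1, if_neg]
    intro h'
    have h₂ := congrFun h' (⟨0, h⟩ : Fin (n + ξ)).succ.succ
    have h₃ : u (⟨0, h⟩ : Fin (n + ξ)).succ.succ = true := congrFun hu _
    have h₄ : z (⟨0, h⟩ : Fin (n + ξ)).succ.succ = true := congrFun hz _
    rw [offFlipMap, Function.update_self, h₃, h₄, h₁, hu1] at h₂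
    exact absurd h₂ (by decide)
  · rw [offFlipMap_of_on h (h₁.trans hu1), ← joinBits_dataBits z, ← joinBits_dataBits u, h₀, h₁,
      hz, hu, hu1, op_phaseBlock_ones, hC]
    simp

theorem dqc1AcceptProb_gapCircuit_eq_zero_iff (hw : 4 ≤ n + ξ) (h : 0 < n + ξ)
    (C : RevCircuit (n + ξ)) :
    dqc1AcceptProb (QCircuit.op (gapCircuit h C)) = 0 ↔ revGap C = 0 := by
  rw [dqc1AcceptProb_eq_zero_iff]
  constructor
  · intro hU
    -- The entry in row `x` and column `offFlipMap h o` isolates the gap: the first block fixes `o`,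
    -- the middle flip takes `o` to `x`, and the second block contributes its diagonal entry at `x`.
    set x : Fin (n + ξ + 2) → Bool := joinBits false true fun _ => true with hx
    set o : Fin (n + ξ + 2) → Bool := joinBits false false fun _ => true with ho
    have hax : ∀ c b, allOnes (joinBits c b fun _ : Fin (n + ξ) => true) = true :=
      fun c b => allOnes_eq_true_iff.mpr rfl
    have h₁ : offFlipMap h (flipIfAllOnes 0 (flipBit 0 x)) = x := by
      have : flipIfAllOnes 0 (flipBit 0 x) = x := by
        have ha : allOnes (flipBit 0 x) = true :=
          (allOnes_congr (dataBits_update_zero _ _)).trans (hax _ _)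
        rw [flipIfAllOnes, ha, flipBit, Function.update_self, Function.update_idem]
        simp
      rw [this]
      exact offFlipMap_of_on h rfl
    have h₂ : offFlipMap h (flipIfAllOnes 0 (offFlipMap h o)) = o := by
      have ha : allOnes (offFlipMap h o) = false := by
        rw [Bool.eq_false_iff, ne_eq, allOnes_eq_true_iff]
        intro h'
        have h₃ := congrFun h' ⟨0, h⟩
        rw [dataBits, offFlipMap, Function.update_self] at h₃
        exact absurd h₃ (by simp [ho, joinBits])
      have : flipIfAllOnes 0 (offFlipMap h o) = offFlipMap h o := by
        rw [flipIfAllOnes, ha, Bool.xor_false, Function.update_eq_self]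
      rw [this, offFlipMap_involutive h]
    have h₃ := hU x (offFlipMap h o) rfl (by rw [offFlipMap_zero]; rfl)
    rw [op_gapCircuit_apply hw, h₁, h₂] at h₃
    simp only [op_phaseBlock_of_off h C (u := o) rfl, mul_ite, mul_one, mul_zero,
      Finset.sum_ite_eq', Finset.mem_univ, if_true] at h₃
    have h₄ : flipIfAllOnes 1 o = x := by
      refine ext_dataBits ?_ ?_ ?_
      · rw [flipIfAllOnes, Function.update_of_ne (by simp)]; rfl
      · rw [flipIfAllOnes, Function.update_self, ho, hax]; rfl
      · rw [flipIfAllOnes, dataBits_update_one]; rfl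
    rw [h₄, hx, op_phaseBlock_ones, div_eq_zero_iff] at h₃
    rcases h₃ with h₃ | h₃
    · exact_mod_cast h₃
    · exact absurd h₃ (pow_ne_zero _ two_ne_zero)
  · intro hC x y hx hy
    rw [op_gapCircuit_apply hw]
    set z := flipIfAllOnes 0 (flipBit 0 x) with hz
    set v := flipIfAllOnes 0 y with hv
    -- In the relabelled row and column, qubit 0 flags all-ones data with opposite signs; hence `z ≠
    -- v`.
    have hz0 : z 0 = !(allOnes z) := by
      rw [hz, allOnes_flipIfAllOnes_zero, flipIfAllOnes, Function.update_self, flipBit,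
        Function.update_self, hx]
      cases allOnes (Function.update x 0 !false) <;> rfl
    have hv0 : v 0 = allOnes v := by
      rw [hv, allOnes_flipIfAllOnes_zero, flipIfAllOnes, Function.update_self, hy, Bool.false_xor]
    set B := QCircuit.op (phaseBlock h C) with hB
    have hne : offFlipMap h z ≠ offFlipMap h v := by
      intro h'
      have : z = v := (offFlipMap_involutive h).injective h'
      rw [this] at hz0
      rw [hz0] at hv0
      revert hv0
      cases allOnes v <;> decide
    have hBB : ∑ u, B (offFlipMap h z) u * B u (offFlipMap h v) = 0 := by
      rw [← Matrix.mul_apply, op_phaseBlock_mul_self, Matrix.one_apply_ne hne]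
    -- Without the middle flip the sum is an off-diagonal entry of B B = 1. It remains to see that
    -- the flip changes no term, which can only be in doubt for all-ones `u`.
    suffices hs : ∑ u, (B (offFlipMap h z) (flipIfAllOnes 1 u) * B u (offFlipMap h v) -
        B (offFlipMap h z) u * B u (offFlipMap h v)) = 0 by
      rwa [Finset.sum_sub_distrib, hBB, sub_zero] at hs
    refine Finset.sum_eq_zero fun u _ => ?_
    by_cases hu : allOnes u = true
    swap
    · have : flipIfAllOnes 1 u = u := by
        rw [flipIfAllOnes, Bool.eq_false_iff.mpr hu, Bool.xor_false, Function.update_eq_self]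
      rw [this, sub_self]
    have hu' : allOnes (flipIfAllOnes 1 u) = true := by rwa [allOnes_flipIfAllOnes_one]
    by_cases hza : allOnes z = true
    · rw [hB, op_phaseBlock_of_gap_eq_zero h hC hza hu, op_phaseBlock_of_gap_eq_zero h hC hza hu']
      simp
    by_cases hva : allOnes v = true
    · rw [hB, op_phaseBlock_symm h C u, op_phaseBlock_of_gap_eq_zero h hC hva hu]
      simp
    rw [Bool.eq_false_iff.mpr hza] at hz0
    rw [Bool.eq_false_iff.mpr hva] at hv0
    -- Now neither `z` nor `v` is all ones, so their qubits 0 differ; B preserves qubit 0, and no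
    -- `u` links them.
    by_cases hzu : z 0 = u 0
    · have : u 0 ≠ offFlipMap h v 0 := by
        rw [offFlipMap_zero, ← hzu, hz0, hv0]
        decide
      rw [hB, op_phaseBlock_eq_zero h C (x := u) (Or.inl this)]
      simp
    · have h₁ : offFlipMap h z 0 ≠ u 0 := by rwa [offFlipMap_zero]
      have h₂ : offFlipMap h z 0 ≠ flipIfAllOnes 1 u 0 := by
        rwa [flipIfAllOnes, Function.update_of_ne (by simp)]
      rw [hB, op_phaseBlock_eq_zero h C (Or.inl h₁), op_phaseBlock_eq_zero h C (Or.inl h₂)]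
      simp

end gapCircuit

/-! ### Sizes and growth -/

theorem length_towerGate_le (N q : ℕ) : (towerGate N q).length ≤ 1 := by
  unfold towerGate
  split_ifs <;> simp

theorem length_ladder_le (N q k : ℕ) : (ladder N q k).length ≤ 2 * k + 1 := by
  induction k generalizing q with
  | zero => rw [ladder_zero]; exact length_towerGate_le N q
  | succ k ih =>
    rw [ladder_succ, List.length_append, List.length_append]
    have := ih (q + 2)
    have := length_towerGate_le N q
    omega

theorem length_allOnesFlip_le (w : ℕ) : (allOnesFlip w).length ≤ 8 * w + 16 := by
  have h₁ := length_ladder_le (w + 2) 1 (w / 2 - 2 + 1)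
  have h₂ := length_ladder_le (w + 2) 3 (w / 2 - 2)
  have h₃ := length_ladder_le (w + 2) 0 ((w + 1) / 2 - 2 + 1)
  have h₄ := length_ladder_le (w + 2) 2 ((w + 1) / 2 - 2)
  simp only [allOnesFlip, allOnesHalf, List.length_append]
  omega

theorem length_gapCircuit_le {n ξ : ℕ} (hw : 0 < n + ξ) (C : RevCircuit (n + ξ)) :
    (gapCircuit hw C).length ≤ 28 * (n + ξ) + 4 * C.length + 65 := by
  have := length_allOnesFlip_le (n + ξ)
  simp only [gapCircuit, phaseBlock, inputLayer, offFlip, swapFirst, lastPhase, List.length_append,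
    List.length_cons, List.length_nil, List.length_map, List.length_reverse, List.length_finRange]
  omega

theorem polynomial_eval_mono (p : Polynomial ℕ) : Monotone fun n : ℕ => p.eval n := by
  intro m n h
  simp only [Polynomial.eval_eq_sum_range]
  exact Finset.sum_le_sum fun i _ => Nat.mul_le_mul_left _ (Nat.pow_le_pow_left h i)

theorem polynomial_eval_isLittleO (p : Polynomial ℕ) {c : ℝ} (hc : 1 < c) :
    (fun n : ℕ => ((p.eval n : ℕ) : ℝ)) =o[atTop] fun n : ℕ => c ^ n := by
  induction p using Polynomial.induction_on' with
  | add p q hp hq =>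
    simp only [Polynomial.eval_add, Nat.cast_add]
    exact hp.add hq
  | monomial k a =>
    simp only [Polynomial.eval_monomial, Nat.cast_mul, Nat.cast_pow]
    exact (isLittleO_pow_const_const_pow_of_one_lt k hc).const_mul_left _

theorem eventually_time_le {ξ : ℕ → ℕ}
    (hξ : (fun n : ℕ => (ξ n : ℝ)) =o[atTop] (fun n : ℕ => (n : ℝ))) {a b : ℝ} (hb : b < 1)
    (hab : b < a) (p : Polynomial ℕ) (K : ℕ) :
    ∀ᶠ n : ℕ in atTop, ((K + 6000 * (n + ξ n + p.eval n + 3) * (n + ξ n + p.eval n + 3) +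
      ⌊(2 : ℝ) ^ ((1 - a) * (n : ℝ))⌋₊ : ℕ) : ℝ) ≤ (2 : ℝ) ^ ((1 - b) * (n : ℝ)) := by
  -- `ξ` need not be a polynomial, but eventually `ξ n ≤ n`, so `2 * X` bounds `n + ξ n`.
  set r : Polynomial ℕ := Polynomial.C K + 6000 * (2 * Polynomial.X + p + 3) *
    (2 * Polynomial.X + p + 3) with hr
  have hre : ∀ n, r.eval n = K + 6000 * (2 * n + p.eval n + 3) * (2 * n + p.eval n + 3) := by
    intro n
    simp [hr]
  have h₁ := polynomial_eval_isLittleO r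
    (Real.one_lt_rpow (one_lt_two) (show (0 : ℝ) < 1 - b by linarith))
  have h₂ : (fun n : ℕ => ((2 : ℝ) ^ (1 - a)) ^ n) =o[atTop]
      fun n : ℕ => ((2 : ℝ) ^ (1 - b)) ^ n :=
    isLittleO_pow_pow_of_lt_left (by positivity)
      (Real.rpow_lt_rpow_of_exponent_lt one_lt_two (by linarith))
  filter_upwards [(h₁.add h₂).def one_pos, hξ.def one_pos] with n hn hn'
  have hξn : ξ n ≤ n := by
    simp only [Real.norm_natCast, one_mul] at hn'
    exact_mod_cast hn'
  rw [one_mul, Real.norm_of_nonneg (by positivity), Real.norm_of_nonneg (by positivity),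
    ← Real.rpow_mul_natCast zero_le_two, ← Real.rpow_mul_natCast zero_le_two, hre] at hn
  refine le_trans ?_ hn
  have hm : K + 6000 * (n + ξ n + p.eval n + 3) * (n + ξ n + p.eval n + 3) ≤
      K + 6000 * (2 * n + p.eval n + 3) * (2 * n + p.eval n + 3) := by
    have h : n + ξ n + p.eval n + 3 ≤ 2 * n + p.eval n + 3 := by omega
    gcongr
  rw [Nat.cast_add]
  exact add_le_add (by exact_mod_cast hm) (Nat.floor_le (by positivity))

/-! ### The nondeterministic algorithm for the gap -/

theorem Prog.HaltsWithin.mono {P : Prog} {x : List Bool} {τ τ' : ℝ} (h : P.HaltsWithin x τ)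
    (hτ : τ ≤ τ') : P.HaltsWithin x τ' := by
  intro ω
  obtain ⟨k, t, σ, hex, ht⟩ := h ω
  exact ⟨k, t, σ, hex, ht.trans hτ⟩

theorem Prog.HaltsWithin.floor {P : Prog} {x : List Bool} {τ : ℝ} (h : P.HaltsWithin x τ) :
    P.HaltsWithin x ⌊τ⌋₊ := by
  intro ω
  obtain ⟨k, t, σ, hex, ht⟩ := h ω
  exact ⟨k, t, σ, hex, by exact_mod_cast Nat.le_floor ht⟩

/-- If the sampler never accepts, then p ≤ ε p, which forces p = 0 as ε < 1; if p = 0, no error is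
allowed at all. -/
theorem SamplesDQC1.nAccepts_iff {N : ℕ} [NeZero N] {S : Prog} {U : QCircuit N} {ε τ : ℝ}
    (hε : ε < 1) (h : SamplesDQC1 S U ε τ) :
    S.NAccepts (qCode U) ↔ dqc1AcceptProb (QCircuit.op U) ≠ 0 := by
  obtain ⟨hh, he⟩ := h
  rw [← not_iff_not, not_not, ← hh.acceptProb_eq_zero_iff]
  have hp := dqc1AcceptProb_nonneg (QCircuit.op U)
  constructor
  · intro h0
    rw [h0, sub_zero, abs_of_nonneg hp] at he
    by_contra hne
    have : 0 < dqc1AcceptProb (QCircuit.op U) := lt_of_le_of_ne hp (Ne.symm hne)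
    nlinarith
  · intro h0
    rw [h0, zero_sub, abs_neg, mul_zero] at he
    exact abs_nonpos_iff.mp he

/-- The sampler `S` fails on a circuit `gapCircuit` with at most `p n` reversible gates. -/
def FailsAt (ξ : ℕ → ℕ) (p : Polynomial ℕ) (a : ℝ) (S : Prog) (n : ℕ) : Prop :=
  ∃ (hw : 0 < n + ξ n) (C : RevCircuit (n + ξ n)), C.length ≤ p.eval n ∧
    ∀ ε : ℝ, ε < 1 → ¬ SamplesDQC1 S (gapCircuit hw C) ε ((2 : ℝ) ^ ((1 - a) * (n : ℝ)))

open Classical in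
/-- Whether a word describes a reversible circuit with nonzero gap. -/
noncomputable def gapTable (ξ : ℕ → ℕ) (x : List Bool) : Bool :=
  decide (∃ (n : ℕ) (C : RevCircuit (n + ξ n)), revCode C = x ∧ revGap C ≠ 0)

theorem gapTable_revCode {ξ : ℕ → ℕ} {n : ℕ} (C : RevCircuit (n + ξ n)) :
    gapTable ξ (revCode C) = true ↔ revGap C ≠ 0 := by
  unfold gapTable
  simp only [decide_eq_true_eq]
  constructor
  · rintro ⟨n', C', h, hC'⟩
    obtain ⟨rfl, h⟩ := revCode_injective h
    rwa [← eq_of_heq h]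
  · exact fun h => ⟨n, C, rfl, h⟩

/-- If `S` succeeded from some `n₀` on, compiling and then running `S` would decide the gap there
within the forbidden time. The conjecture asks for correctness at every `n > 0`, which a finite
table for the small cases provides. -/
theorem frequently_failsAt {ξ : ℕ → ℕ}
    (hξ : (fun n : ℕ => (ξ n : ℝ)) =o[atTop] (fun n : ℕ => (n : ℝ))) {a b : ℝ} (hb : b < 1)
    (hab : b < a) {p : Polynomial ℕ}
    (hp : ∀ (A : Prog) (T : ℕ → ℕ),
      (∀ n : ℕ, 0 < n → ∀ C : RevCircuit (n + ξ n), C.length ≤ p.eval n →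
        A.HaltsWithin (revCode C) (T n) ∧ (A.NAccepts (revCode C) ↔ revGap C ≠ 0)) →
      ∃ᶠ n : ℕ in atTop, (2 : ℝ) ^ ((1 - b) * (n : ℝ)) < (T n : ℝ)) (S : Prog) :
    ∃ᶠ n : ℕ in atTop, FailsAt ξ p a S n := by
  intro hev
  -- The bound `4` guarantees enough data qubits for the ladders.
  obtain ⟨n₀, hn₀⟩ := eventually_atTop.mp (hev.and (eventually_ge_atTop 4))
  set B : ℕ → ℕ := fun n => n + ξ n + 2 + p.eval n * (3 * (n + ξ n) + 2)
  -- Admissible descriptions with `n < n₀` are shorter than `L`, so every longer one has `n₀ ≤ n`.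
  -- Short ones with larger `n` are answered by the table too, also correctly.
  set L : ℕ := ∑ n ∈ Finset.range n₀, B n + 1
  have hlen : ∀ n (C : RevCircuit (n + ξ n)), C.length ≤ p.eval n → (revCode C).length ≤ B n :=
    fun n C hC => (revCode_length_le C).trans
      (Nat.add_le_add_left (Nat.mul_le_mul_right _ hC) _)
  set T : ℕ → ℕ := fun n => (3 * L + 2) +
    6000 * (n + ξ n + p.eval n + 3) * (n + ξ n + p.eval n + 3) +
      ⌊(2 : ℝ) ^ ((1 - a) * (n : ℝ))⌋₊ with hT
  refine hp (lookupFrom (gapTable ξ) (compileGap ⨾ S) L []) T (fun n hn C hC => ?_) ?_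
  · rcases lt_or_ge (revCode C).length L with hL | hL
    · obtain ⟨d, hd, hr⟩ := lookupFrom_short (gapTable ξ) (compileGap ⨾ S) L [] (revCode C) hL
      refine ⟨(hr.haltsWithin (haltsWithin_push _ _)).mono ?_, ?_⟩
      · have : 1 + d ≤ T n := by simp only [hT]; omega
        exact_mod_cast this
      · rw [hr.nAccepts_iff, nAccepts_push_iff]
        exact gapTable_revCode C
    · have hn0 : n₀ ≤ n := by
        by_contra hlt
        have h₁ := Finset.single_le_sum (f := B) (fun i _ => Nat.zero_le _)
          (Finset.mem_range.mpr (not_le.mp hlt))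
        have h₂ := hlen n C hC
        omega
      obtain ⟨hnf, hn4⟩ := hn₀ n hn0
      have hw : 0 < n + ξ n := by omega
      obtain ⟨ε, hε, hs⟩ : ∃ ε : ℝ, ε < 1 ∧
          SamplesDQC1 S (gapCircuit hw C) ε ((2 : ℝ) ^ ((1 - a) * (n : ℝ))) := by
        by_contra hcon
        push Not at hcon
        exact hnf ⟨hw, C, hC, hcon⟩
      obtain ⟨d, hd, hr⟩ := lookupFrom_long (gapTable ξ) (compileGap ⨾ S) L [] (revCode C) hL
      obtain ⟨t, ht, hex⟩ := exec_compileGap (n := n) (ξ := ξ n) (by omega) C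
      have hr' := hr.trans (Reduces.seq (Q := S) hex)
      refine ⟨(Reduces.haltsWithin hr' hs.1.floor).mono ?_, ?_⟩
      · have h₁ : 6000 * (n + ξ n + C.length + 3) * (n + ξ n + C.length + 3) ≤
            6000 * (n + ξ n + p.eval n + 3) * (n + ξ n + p.eval n + 3) := by gcongr
        have h₂ : ⌊(2 : ℝ) ^ ((1 - a) * (n : ℝ))⌋₊ + (d + t) ≤ T n := by
          simp only [hT]
          simp only [List.length_nil] at hd
          omega
        exact_mod_cast h₂
      · rw [Reduces.nAccepts_iff hr', hs.nAccepts_iff hε, ne_eq,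
          dqc1AcceptProb_gapCircuit_eq_zero_iff (by omega)]
  · filter_upwards [eventually_time_le hξ hb hab p (3 * L + 2)] with n h
    exact not_lt.mpr h

/-! ### Diagonalisation against all samplers -/

theorem theorem3 (ξ : ℕ → ℕ)
    (hξ : (fun n : ℕ => (ξ n : ℝ)) =o[atTop] (fun n : ℕ => (n : ℝ)))
    (hconj : ReversibleGapConjecture ξ) :
    ∀ a : ℝ, 0 < a →
      (∃ (q : Polynomial ℕ) (U : (n : ℕ) → QCircuit (n + ξ n + 2)),
        (∀ n : ℕ, (U n).length ≤ q.eval (n + ξ n + 2)) ∧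
        ∀ S : Prog,
          {N : ℕ | ∃ n : ℕ, N = n + ξ n + 2 ∧ ∀ ε : ℝ, ε < 1 →
            ¬ SamplesDQC1 S (U n) ε
              ((2 : ℝ) ^ ((1 - a) * ((N : ℝ) - (ξ n : ℝ) - 2)))}.Infinite) ∧
      (fun n : ℕ => (1 - a) * (((n + ξ n + 2 : ℕ) : ℝ) - (ξ n : ℝ) - 2)
          - (1 - a) * ((n + ξ n + 2 : ℕ) : ℝ))
        =o[atTop] (fun n : ℕ => ((n + ξ n + 2 : ℕ) : ℝ)) := by
  intro a ha
  constructor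
  -- The conjecture is applied with `min a 1 / 2`: below `a` to absorb the overhead, and below `1`
  -- because `a` may be large.
  · have hmin : 0 < min a 1 := lt_min ha one_pos
    obtain ⟨p, hp⟩ := hconj (min a 1 / 2) (by linarith)
    have hfreq := frequently_failsAt hξ (b := min a 1 / 2) (a := a)
      (by have := min_le_right a 1; linarith) (by have := min_le_left a 1; linarith) hp
    have : Nonempty Prog := ⟨Prog.skip⟩
    obtain ⟨e, he⟩ := exists_surjective_nat Prog
    -- The length `φ k` is reserved for defeating sampler number `(Nat.unpair k).1`. Each sampler
    -- has infinitely many `k`, and strict monotonicity prevents conflicts.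
    obtain ⟨φ, hφ, hfail⟩ := extraction_forall_of_frequently
      (P := fun k n => FailsAt ξ p a (e (Nat.unpair k).1) n) fun k => hfreq _
    have hU : ∀ n, ∃ V : QCircuit (n + ξ n + 2),
        V.length ≤ (4 * p + 28 * Polynomial.X + 65).eval (n + ξ n + 2) ∧
        ∀ k, φ k = n → ∀ ε : ℝ, ε < 1 →
          ¬ SamplesDQC1 (e (Nat.unpair k).1) V ε ((2 : ℝ) ^ ((1 - a) * (n : ℝ))) := by
      intro n
      by_cases hn : ∃ k, φ k = n
      · obtain ⟨k, rfl⟩ := hn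
        obtain ⟨hw, C, hC, hs⟩ := hfail k
        refine ⟨gapCircuit hw C, ?_, fun k' hk' => ?_⟩
        · have h₁ := length_gapCircuit_le hw C
          have h₂ : p.eval (φ k) ≤ p.eval (φ k + ξ (φ k) + 2) :=
            polynomial_eval_mono p (by omega)
          simp only [Polynomial.eval_add, Polynomial.eval_mul, Polynomial.eval_ofNat,
            Polynomial.eval_X]
          omega
        · rw [hφ.injective hk']
          exact hs
      -- Nothing is required at unreserved lengths, so the empty circuit serves there.
      · exact ⟨[], by simp, fun k hk => absurd ⟨k, hk⟩ hn⟩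
    choose U hUlen hUfail using hU
    refine ⟨_, U, hUlen, fun S => ?_⟩
    obtain ⟨j, rfl⟩ := he S
    refine Set.infinite_of_forall_exists_gt fun m => ?_
    -- `m ≤ Nat.pair j m ≤ φ (Nat.pair j m)`, so this failure of sampler `j` lies beyond `m`.
    refine ⟨φ (Nat.pair j m) + ξ (φ (Nat.pair j m)) + 2, ⟨φ (Nat.pair j m), rfl, ?_⟩, ?_⟩
    · have h := hUfail _ (Nat.pair j m) rfl
      rw [Nat.unpair_pair] at h
      have hN : (((φ (Nat.pair j m) + ξ (φ (Nat.pair j m)) + 2 : ℕ) : ℝ) -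
          (ξ (φ (Nat.pair j m)) : ℝ) - 2) = (φ (Nat.pair j m) : ℝ) := by
        push_cast
        ring
      rw [hN]
      exact h
    · have h₁ := hφ.id_le (Nat.pair j m)
      have h₂ := Nat.right_le_pair j m
      simp only [id] at h₁
      omega
  -- The exponents differ by `-(1 - a) * (ξ n + 2)`, which is o(n), and `n ≤ N`.
  · have hn : (fun n : ℕ => (n : ℝ)) =O[atTop] fun n : ℕ => ((n + ξ n + 2 : ℕ) : ℝ) := by
      refine IsBigO.of_bound 1 (Eventually.of_forall fun n => ?_)
      rw [Real.norm_natCast, Real.norm_natCast, one_mul]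
      exact_mod_cast (by omega : n ≤ n + ξ n + 2)
    have h2 : (fun _ : ℕ => (2 : ℝ)) =o[atTop] fun n : ℕ => (n : ℝ) :=
      isLittleO_const_left.mpr (Or.inr (tendsto_norm_atTop_atTop.comp
        tendsto_natCast_atTop_atTop))
    refine (((hξ.add h2).trans_isBigO hn).const_mul_left (-(1 - a))).congr_left fun n => ?_
    push_cast
    ring
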